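/- Let $\mathbb F=\mathbb R$ or $\mathbb F=\mathbb C$, let $P_0,P_1\in\mathbb F^{d\times d}$ with $P_1$ Hermitian and invertible, and let $n_1$ and $n_2=d-n_1$ be the numbers of positive and of negative eigenvalues of $P_1$, counted with multiplicity. Write $$P_1=S^{-1}\begin{bmatrix}\Lambda&0\\0&\Theta\end{bmatrix}S$$ with $S\in\mathbb F^{d\times d}$ unitary, $\Lambda\in\mathbb R^{n_1\times n_1}$ diagonal and positive definite, and $\Theta\in\mathbb R^{n_2\times n_2}$ diagonal and negative definite. Let $\mathcal H:[0,\infty)\to\mathbb F^{d\times d}$ be measurable with $\mathcal H(\zeta)$ (Hermitian) positive definite for a.e. $\zeta$ and $\mathcal H,\mathcal H^{-1}\in L^\infty([0,\infty);\mathbb F^{d\times d})$. Let $\hat W_B\in\mathbb F^{k\times d}$ have full row rank, $\operatorname{rank}\hat W_B=k$, with $k\le n_2$. On $X=L^2([0,\infty);\mathbb F^d)$ with its standard inner product $\langle\cdot,\cdot\rangle$ let $$Ax=P_0x+P_1\frac{\partial x}{\partial\zeta},\qquad D(A)=\{x\in W^{1,2}([0,\infty);\mathbb F^d)\mid \hat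 W_B\,x(0)=0\},$$ and let $A\mathcal H$ be the operator $x\mapsto A(\mathcal Hx)$ with domain $D(A\mathcal H)=\{x\in X\mid \mathcal Hx\in D(A)\}$. Write $\operatorname{Re}P_0=\frac12(P_0+P_0^*)$. Then the following statements are equivalent: 1. $A\mathcal H$ generates a strongly continuous semigroup of contractions on $X$ equipped with the inner product $\langle\cdot,\mathcal H\cdot\rangle$; 2. $A$ is dissipative, that is, $\operatorname{Re}\langle Ax,x\rangle\le0$ for every $x\in D(A)$; 3. $\operatorname{Re}P_0\le0$ and $y^*P_1y\ge0$ for every $y\in\ker\hat W_B$; 4. $\operatorname{Re}P_0\le0$, $k=n_2$, and $\hat W_B=B\begin{bmatrix}U&I\end{bmatrix}S$ for some invertible $B\in\mathbb F^{n_2\times n_2}$ and some $U\in\mathbb F^{n_2\times n_1}$ with $\Lambda+U^*\Theta U\ge0$. -/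

import Mathlib

open MeasureTheory Filter Topology Set
open scoped NNReal ENNReal Matrix ComplexOrder ContDiff

namespace PortHam

noncomputable section

/-! ### Contraction semigroups and their generators -/

/-- `T` is a strongly continuous (`C₀`-)semigroup of contractions on the vector space `E` equipped
with the norm `p`; convergence is convergence with respect to `p`. -/
structure IsContractionSemigroup {𝕜 E : Type*} [RCLike 𝕜] [AddCommGroup E] [Module 𝕜 E]
    (p : E → ℝ) (T : ℝ≥0 → E →ₗ[𝕜] E) : Prop where
  map_zero : T 0 = LinearMap.id
  map_add : ∀ s t : ℝ≥0, T (s + t) = T s ∘ₗ T t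
  strong_continuity : ∀ x : E, Tendsto (fun t : ℝ≥0 => p (T t x - x)) (𝓝 0) (𝓝 0)
  contraction : ∀ (t : ℝ≥0) (x : E), p (T t x) ≤ p x

/-- The (unbounded) operator `A` is the infinitesimal generator of the semigroup `T` on `E` with
norm `p`: `x ∈ D(A)` and `A x = y` if and only if `(T(t) x - x) / t → y` as `t ↓ 0`. -/
def IsGenerator {𝕜 E : Type*} [RCLike 𝕜] [AddCommGroup E] [Module 𝕜 E]
    (p : E → ℝ) (T : ℝ≥0 → E →ₗ[𝕜] E) (A : E →ₗ.[𝕜] E) : Prop :=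
  ∀ x y : E, (∃ hx : x ∈ A.domain, A ⟨x, hx⟩ = y) ↔
    Tendsto (fun t : ℝ≥0 => p ((((t : ℝ)⁻¹ : ℝ) : 𝕜) • (T t x - x) - y)) (𝓝[>] 0) (𝓝 0)

/-- `A` generates a contraction semigroup on `E` equipped with the norm `p`. -/
def GeneratesContractionSemigroup {𝕜 E : Type*} [RCLike 𝕜] [AddCommGroup E] [Module 𝕜 E]
    (p : E → ℝ) (A : E →ₗ.[𝕜] E) : Prop :=
  ∃ T : ℝ≥0 → E →ₗ[𝕜] E, IsContractionSemigroup p T ∧ IsGenerator p T A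

/-- `A` is dissipative: `Re ⟨A x, x⟩ ≤ 0` for every `x ∈ D(A)`. -/
def IsDissipative {𝕜 E : Type*} [RCLike 𝕜] [NormedAddCommGroup E] [InnerProductSpace 𝕜 E]
    (A : E →ₗ.[𝕜] E) : Prop :=
  ∀ x : A.domain, RCLike.re (inner 𝕜 (A x) (x : E)) ≤ 0

/-! ### The space `L²([0,∞); 𝕜^d)`, weak derivatives and boundary values -/

/-- Lebesgue measure on the half-line `[0,∞)`. -/
abbrev halfLine : Measure ℝ := volume.restrict (Ici 0)

/-- `X = L²([0,∞); 𝕜^d)` with its standard inner product. -/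
abbrev L2 (𝕜 : Type*) [RCLike 𝕜] (d : ℕ) : Type _ := Lp (EuclideanSpace 𝕜 (Fin d)) 2 halfLine

variable {𝕜 : Type*} [RCLike 𝕜] {d : ℕ}

/-- `v` is the weak derivative of `u` on the half-line: `∫ φ' u = - ∫ φ v` for every smooth `φ`
with compact support in the open interval `(0,∞)`. -/
def HasWeakDeriv (u v : L2 𝕜 d) : Prop :=
  ∀ φ : ℝ → ℝ, ContDiff ℝ ∞ φ → HasCompactSupport φ → tsupport φ ⊆ Ioi 0 →
    ∫ ζ, deriv φ ζ • u ζ ∂halfLine = - ∫ ζ, φ ζ • v ζ ∂halfLine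

/-- `a` is the boundary value `u(0)`: the value at `0` of a representative of `u` that is
continuous on `[0,∞)`. -/
def HasBoundaryValue (u : L2 𝕜 d) (a : EuclideanSpace 𝕜 (Fin d)) : Prop :=
  ∃ f : ℝ → EuclideanSpace 𝕜 (Fin d), ContinuousOn f (Ici 0) ∧ u =ᵐ[halfLine] f ∧ f 0 = a

theorem integrable_smul_L2 {φ : ℝ → ℝ} (hφ : Continuous φ) (hc : HasCompactSupport φ)
    (u : L2 𝕜 d) : Integrable (fun ζ => φ ζ • u ζ) halfLine := by
  have h : MemLp φ 2 halfLine := (hφ.memLp_of_hasCompactSupport hc)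
  rw [← memLp_one_iff_integrable]
  exact MemLp.smul (Lp.memLp u) h

theorem HasWeakDeriv.add {u v u' v' : L2 𝕜 d} (h : HasWeakDeriv u v) (h' : HasWeakDeriv u' v') :
    HasWeakDeriv (u + u') (v + v') := by
  intro φ hφ hc hs
  have hφ' : Continuous (deriv φ) := hφ.continuous_deriv (by simp)
  have e1 : ∫ ζ, deriv φ ζ • (u + u') ζ ∂halfLine
      = ∫ ζ, (deriv φ ζ • u ζ + deriv φ ζ • u' ζ) ∂halfLine := by
    refine integral_congr_ae ?_
    filter_upwards [Lp.coeFn_add u u'] with ζ hζ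
    rw [hζ, Pi.add_apply, smul_add]
  have e2 : ∫ ζ, φ ζ • (v + v') ζ ∂halfLine
      = ∫ ζ, (φ ζ • v ζ + φ ζ • v' ζ) ∂halfLine := by
    refine integral_congr_ae ?_
    filter_upwards [Lp.coeFn_add v v'] with ζ hζ
    rw [hζ, Pi.add_apply, smul_add]
  rw [e1, e2, integral_add (integrable_smul_L2 hφ' hc.deriv u) (integrable_smul_L2 hφ' hc.deriv u'),
    integral_add (integrable_smul_L2 hφ.continuous hc v) (integrable_smul_L2 hφ.continuous hc v'),
    h φ hφ hc hs, h' φ hφ hc hs, neg_add]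

theorem HasWeakDeriv.smul {u v : L2 𝕜 d} (c : 𝕜) (h : HasWeakDeriv u v) :
    HasWeakDeriv (c • u) (c • v) := by
  intro φ hφ hc hs
  have e1 : ∫ ζ, deriv φ ζ • (c • u) ζ ∂halfLine = ∫ ζ, c • (deriv φ ζ • u ζ) ∂halfLine := by
    refine integral_congr_ae ?_
    filter_upwards [Lp.coeFn_smul c u] with ζ hζ
    rw [hζ, Pi.smul_apply, smul_comm]
  have e2 : ∫ ζ, φ ζ • (c • v) ζ ∂halfLine = ∫ ζ, c • (φ ζ • v ζ) ∂halfLine := by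
    refine integral_congr_ae ?_
    filter_upwards [Lp.coeFn_smul c v] with ζ hζ
    rw [hζ, Pi.smul_apply, smul_comm]
  rw [e1, e2, integral_smul, integral_smul, h φ hφ hc hs, smul_neg]

theorem hasWeakDeriv_zero : HasWeakDeriv (0 : L2 𝕜 d) 0 := by
  intro φ hφ hc hs
  have e : ∀ ψ : ℝ → ℝ, ∫ ζ, ψ ζ • (0 : L2 𝕜 d) ζ ∂halfLine = 0 := by
    intro ψ
    refine integral_eq_zero_of_ae ?_
    filter_upwards [Lp.coeFn_zero (EuclideanSpace 𝕜 (Fin d)) 2 halfLine] with ζ hζ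
    rw [hζ]
    simp
  rw [e, e, neg_zero]

theorem HasWeakDeriv.unique {u v w : L2 𝕜 d} (hv : HasWeakDeriv u v) (hw : HasWeakDeriv u w) :
    v = w := by
  have key : ∀ᵐ ζ ∂halfLine, ζ ∈ Ioi (0 : ℝ) → (fun ζ => v ζ - w ζ) ζ = 0 := by
    refine isOpen_Ioi.ae_eq_zero_of_integral_contDiff_smul_eq_zero ?_ ?_
    · exact (((Lp.memLp v).locallyIntegrable (by norm_num)).sub
        ((Lp.memLp w).locallyIntegrable (by norm_num))).locallyIntegrableOn _
    · intro g hg hc hs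
      have h1 := (hv g hg hc hs).symm.trans (hw g hg hc hs)
      simp only [smul_sub]
      rw [integral_sub (integrable_smul_L2 hg.continuous hc v)
        (integrable_smul_L2 hg.continuous hc w), neg_injective h1, sub_self]
  refine Lp.ext ?_
  have hpos : ∀ᵐ ζ ∂halfLine, ζ ∈ Ioi (0 : ℝ) := by
    have h : halfLine = volume.restrict (Ioi (0 : ℝ)) := (restrict_Ioi_eq_restrict_Ici).symm
    rw [h]
    exact ae_restrict_mem measurableSet_Ioi
  filter_upwards [key, hpos] with ζ h1 h2
  exact sub_eq_zero.1 (h1 h2)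

/-- The Sobolev space `W^{1,2}([0,∞); 𝕜^d)`. -/
def W12 (𝕜 : Type*) [RCLike 𝕜] (d : ℕ) : Submodule 𝕜 (L2 𝕜 d) where
  carrier := {u | ∃ v, HasWeakDeriv u v}
  add_mem' := fun ⟨v, h⟩ ⟨v', h'⟩ => ⟨v + v', h.add h'⟩
  zero_mem' := ⟨0, hasWeakDeriv_zero⟩
  smul_mem' := fun c _ ⟨v, h⟩ => ⟨c • v, h.smul c⟩

/-- The weak derivative `∂/∂ζ : W^{1,2}([0,∞); 𝕜^d) → L²([0,∞); 𝕜^d)`. -/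
def weakDeriv (𝕜 : Type*) [RCLike 𝕜] (d : ℕ) : W12 𝕜 d →ₗ[𝕜] L2 𝕜 d where
  toFun u := u.2.choose
  map_add' u u' := (u + u').2.choose_spec.unique (u.2.choose_spec.add u'.2.choose_spec)
  map_smul' c u := (c • u).2.choose_spec.unique (u.2.choose_spec.smul c)

/-! ### The operators `A` and `A𝓗` -/

/-- Pointwise application of the constant matrix `P` on `L²([0,∞); 𝕜^d)`. -/
def constOp (P : Matrix (Fin d) (Fin d) 𝕜) : L2 𝕜 d →ₗ[𝕜] L2 𝕜 d :=
  ((Matrix.toEuclideanCLM (n := Fin d) (𝕜 := 𝕜) P).compLpL 2 halfLine).toLinearMap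

/-- `D(A) = {x ∈ W^{1,2}([0,∞); 𝕜^d) | W x(0) = 0}`. -/
def domainA {k : ℕ} (W : Matrix (Fin k) (Fin d) 𝕜) : Submodule 𝕜 (L2 𝕜 d) where
  carrier := {u | u ∈ W12 𝕜 d ∧
    ∃ a : EuclideanSpace 𝕜 (Fin d), HasBoundaryValue u a ∧ W *ᵥ a.ofLp = 0}
  add_mem' := by
    rintro u u' ⟨hu, a, ⟨f, hf, huf, hfa⟩, ha⟩ ⟨hu', a', ⟨f', hf', huf', hfa'⟩, ha'⟩
    refine ⟨add_mem hu hu', a + a', ⟨f + f', hf.add hf', ?_, by simp [hfa, hfa']⟩, ?_⟩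
    · exact (Lp.coeFn_add u u').trans (huf.add huf')
    · rw [WithLp.ofLp_add, Matrix.mulVec_add, ha, ha', add_zero]
  zero_mem' := by
    refine ⟨zero_mem _, 0, ⟨0, continuousOn_const, Lp.coeFn_zero _ _ _, rfl⟩, ?_⟩
    simp
  smul_mem' := by
    rintro c u ⟨hu, a, ⟨f, hf, huf, hfa⟩, ha⟩
    refine ⟨Submodule.smul_mem _ c hu, c • a, ⟨c • f, hf.const_smul c, ?_, by simp [hfa]⟩, ?_⟩
    · exact (Lp.coeFn_smul c u).trans (huf.const_smul c)
    · rw [WithLp.ofLp_smul, Matrix.mulVec_smul, ha, smul_zero]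

theorem domainA_le_W12 {k : ℕ} (W : Matrix (Fin k) (Fin d) 𝕜) : domainA W ≤ W12 𝕜 d :=
  fun _ hu => hu.1

/-- The operator `A x = P₀ x + P₁ ∂x/∂ζ` with domain `D(A)`. -/
def opA {k : ℕ} (P₀ P₁ : Matrix (Fin d) (Fin d) 𝕜) (W : Matrix (Fin k) (Fin d) 𝕜) :
    L2 𝕜 d →ₗ.[𝕜] L2 𝕜 d where
  domain := domainA W
  toFun := constOp P₀ ∘ₗ (domainA W).subtype +
    constOp P₁ ∘ₗ weakDeriv 𝕜 d ∘ₗ Submodule.inclusion (domainA_le_W12 W)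

/-- The matrix-valued function `G` belongs to `L^∞([0,∞); 𝕜^{d×d})`. -/
def EssBounded (G : ℝ → Matrix (Fin d) (Fin d) 𝕜) : Prop :=
  ∀ i j, MemLp (fun ζ => G ζ i j) ∞ halfLine

theorem EssBounded.memLp_mulVec {G : ℝ → Matrix (Fin d) (Fin d) 𝕜} (hG : EssBounded G)
    (u : L2 𝕜 d) :
    MemLp (fun ζ => WithLp.toLp 2 (G ζ *ᵥ (u ζ).ofLp) : ℝ → EuclideanSpace 𝕜 (Fin d)) 2
      halfLine := by
  refine MemLp.of_eval_piLp fun i => ?_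
  simp only [Matrix.mulVec, dotProduct]
  refine memLp_finsetSum _ fun j _ => ?_
  exact MemLp.mul ((Lp.memLp u).eval_piLp j) (hG i j)

/-- The multiplication operator `(G x)(ζ) = G(ζ) x(ζ)` on `L²([0,∞); 𝕜^d)`. -/
def mulOp (G : ℝ → Matrix (Fin d) (Fin d) 𝕜) (hG : EssBounded G) : L2 𝕜 d →ₗ[𝕜] L2 𝕜 d where
  toFun u := (hG.memLp_mulVec u).toLp _
  map_add' u v := by
    rw [← MemLp.toLp_add]
    refine MemLp.toLp_congr _ _ ?_
    filter_upwards [Lp.coeFn_add u v] with ζ hζ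
    rw [hζ]
    simp [Matrix.mulVec_add]
  map_smul' c u := by
    rw [RingHom.id_apply, ← MemLp.toLp_const_smul]
    refine MemLp.toLp_congr _ _ ?_
    filter_upwards [Lp.coeFn_smul c u] with ζ hζ
    rw [hζ]
    simp [Matrix.mulVec_smul]

/-- The operator `A𝓗` with domain `D(A𝓗) = {x ∈ X | 𝓗 x ∈ D(A)}`. -/
def opAH {k : ℕ} (P₀ P₁ : Matrix (Fin d) (Fin d) 𝕜) (W : Matrix (Fin k) (Fin d) 𝕜)
    (G : ℝ → Matrix (Fin d) (Fin d) 𝕜) (hG : EssBounded G) : L2 𝕜 d →ₗ.[𝕜] L2 𝕜 d where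
  domain := (domainA W).comap (mulOp G hG)
  toFun := (opA P₀ P₁ W).toFun ∘ₗ (mulOp G hG).restrict (fun _ hx => hx)

/-- The norm `‖x‖ = ⟨x, 𝓗 x⟩^{1/2}` of the space `(X, ⟨·, 𝓗 ·⟩)`. -/
def energyNorm (G : ℝ → Matrix (Fin d) (Fin d) 𝕜) (hG : EssBounded G) (x : L2 𝕜 d) : ℝ :=
  √(RCLike.re (inner 𝕜 x (mulOp G hG x)))

/-! ### Matrices -/

/-- `Re P = (P + P*) / 2`. -/
def matRe (P : Matrix (Fin d) (Fin d) 𝕜) : Matrix (Fin d) (Fin d) 𝕜 :=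
  (2⁻¹ : 𝕜) • (P + Pᴴ)

/-- `P ≤ 0`: `x* P x ≤ 0` for all `x` (in the order of `𝕜`, so `x* P x` is real). -/
def NegSemidef (P : Matrix (Fin d) (Fin d) 𝕜) : Prop :=
  ∀ x : Fin d → 𝕜, star x ⬝ᵥ (P *ᵥ x) ≤ 0

/-- The number of positive eigenvalues of a Hermitian matrix, counted with multiplicity. -/
def numPosEigenvalues {P : Matrix (Fin d) (Fin d) 𝕜} (hP : P.IsHermitian) : ℕ :=
  (Finset.univ.filter fun i => 0 < hP.eigenvalues i).card

/-- The number of negative eigenvalues of a Hermitian matrix, counted with multiplicity. -/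
def numNegEigenvalues {P : Matrix (Fin d) (Fin d) 𝕜} (hP : P.IsHermitian) : ℕ :=
  (Finset.univ.filter fun i => hP.eigenvalues i < 0).card

/-- The splitting of the `d = n₁ + n₂` coordinates into the first `n₁` and the last `n₂`. -/
def blockEquiv {n₁ n₂ d : ℕ} (h : n₁ + n₂ = d) : Fin n₁ ⊕ Fin n₂ ≃ Fin d :=
  finSumFinEquiv.trans (finCongr h)

/-- The diagonal matrix over `𝕜` with the real diagonal entries `l`. -/
def realDiag (𝕜 : Type*) [RCLike 𝕜] {n : ℕ} (l : Fin n → ℝ) : Matrix (Fin n) (Fin n) 𝕜 :=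
  Matrix.diagonal fun i => (l i : 𝕜)

/-- The `d × d` block diagonal matrix `[[Λ, 0], [0, Θ]]`. -/
def blockDiag {n₁ n₂ d : ℕ} (h : n₁ + n₂ = d) (Λ : Matrix (Fin n₁) (Fin n₁) 𝕜)
    (Θ : Matrix (Fin n₂) (Fin n₂) 𝕜) : Matrix (Fin d) (Fin d) 𝕜 :=
  (Matrix.fromBlocks Λ 0 0 Θ).reindex (blockEquiv h) (blockEquiv h)

/-- The `n₂ × d` block matrix `[U  I]`. -/
def blockRow {n₁ n₂ d : ℕ} (h : n₁ + n₂ = d) (U : Matrix (Fin n₂) (Fin n₁) 𝕜) :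
    Matrix (Fin n₂) (Fin d) 𝕜 :=
  (Matrix.fromCols U (1 : Matrix (Fin n₂) (Fin n₂) 𝕜)).reindex (Equiv.refl _) (blockEquiv h)

end

end PortHam

/-! Everything rests on the energy balance `Re ⟨A u, u⟩ = Re ⟨P₀ u, u⟩ - u(0)* P₁ u(0) / 2` on
`D(A)` (`re_inner_opA`), which is integration by parts on the half-line: an element of `W^{1,2}`
agrees a.e. with a primitive of its weak derivative, and its boundary term at infinity vanishes.

2 ⇔ 3. The balance gives dissipativity from the two sign conditions. Conversely, exponentials are
explicit elements of `D(A)`: `(exp(-t) - exp(-2t)) y` vanishes at `0` and isolates `P₀`, while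
`exp(-s t) y` with `y ∈ ker W` and `s` large isolates the boundary term.

3 ⇔ 4. This is linear algebra of a form of signature `(n₁, n₂)` (`forall_ker_nonneg_iff`). A
subspace on which the form is nonnegative has dimension at most `n₁`, so `d - k ≤ n₁`, which forces
`k = n₂`. In the coordinates `S y = (x, z)` the `z`-block of `W S⁻¹` must then be invertible, the
kernel is the graph `z = -U x`, and the form on it is `x* (Λ + U* Θ U) x`.

1 ⇔ 2. With `u = 𝓗 x`, the energy inner product of `A𝓗 x` with `x` is `⟨A u, u⟩`, so `A𝓗` is
dissipative for the energy exactly when `A` is for the standard inner product. A generator of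
contractions is dissipative. For the converse, the Lumer–Phillips theorem (proved by Yosida
approximation) requires solving `l 𝓗⁻¹ u - A u = y`. The range of the left side is closed, because
`𝓗⁻¹` is coercive and `A` is closed. An element `w` orthogonal to it solves the adjoint equation and
has `P₁ w(0)` orthogonal to `ker W`. As `ker W` is nonnegative of the maximal dimension `n₁`, this
forces `w(0)* P₁ w(0) ≤ 0`, and the energy balance for the adjoint equation then gives `w = 0`
(`eq_zero_of_forall_inner_eq_zero`). -/

namespace PortHam

noncomputable section

/-! ### Exponentials of bounded operators -/

section BoundedGenerator

variable {𝕜 E : Type*} [RCLike 𝕜] [NormedAddCommGroup E] [NormedSpace 𝕜 E]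

/-- The group `t ↦ exp (t B)` generated by a bounded operator. -/
def expGroup (B : E →L[𝕜] E) (t : ℝ) : E →L[𝕜] E := NormedSpace.exp ((t : 𝕜) • B)

theorem expGroup_zero (B : E →L[𝕜] E) : expGroup B 0 = 1 := by
  simp [expGroup, NormedSpace.exp_zero]

theorem commute_expGroup {B C : E →L[𝕜] E} (h : Commute B C) (t : ℝ) :
    Commute C (expGroup B t) := by
  let : NormedAlgebra ℚ (E →L[𝕜] E) := NormedAlgebra.restrictScalars ℚ 𝕜 _
  exact (h.symm.smul_right _).exp_right

variable [CompleteSpace E]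

theorem expGroup_add (B : E →L[𝕜] E) (s t : ℝ) :
    expGroup B (s + t) = expGroup B s * expGroup B t := by
  let : NormedAlgebra ℚ (E →L[𝕜] E) := NormedAlgebra.restrictScalars ℚ 𝕜 _
  rw [expGroup, RCLike.ofReal_add, add_smul, NormedSpace.exp_add_of_commute]
  · rfl
  · exact ((Commute.refl B).smul_left _).smul_right _

/-- Two forms of one path from `exp (t C)` to `exp (t B)`: the right side is easy to differentiate
in `s`, the left side is visibly a contraction for `0 ≤ s ≤ t`. -/
theorem expGroup_eq_mul_of_commute {B C : E →L[𝕜] E} (h : Commute B C) (s t : ℝ) :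
    expGroup B s * expGroup C (t - s) = expGroup (B - C) s * expGroup C t := by
  let : NormedAlgebra ℚ (E →L[𝕜] E) := NormedAlgebra.restrictScalars ℚ 𝕜 _
  have h1 : Commute ((s : 𝕜) • B) (((t - s : ℝ) : 𝕜) • C) := (h.smul_left _).smul_right _
  have h2 : Commute ((s : 𝕜) • (B - C)) ((t : 𝕜) • C) :=
    ((h.sub_left (Commute.refl C)).smul_left _).smul_right _
  simp only [expGroup]
  rw [← NormedSpace.exp_add_of_commute h1, ← NormedSpace.exp_add_of_commute h2]
  congr 1
  simp only [RCLike.ofReal_sub, smul_sub, sub_smul]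
  abel

variable [NormedSpace ℝ E] [IsScalarTower ℝ 𝕜 E]

theorem hasDerivAt_expGroup_apply (B : E →L[𝕜] E) (x : E) (t : ℝ) :
    HasDerivAt (fun s : ℝ => expGroup B s x) (expGroup B t (B x)) t := by
  have h1 : HasDerivAt (fun u : 𝕜 => NormedSpace.exp (u • B))
      (NormedSpace.exp ((t : 𝕜) • B) * B) (t : 𝕜) := hasDerivAt_exp_smul_const B (t : 𝕜)
  have h2 : HasDerivAt (fun u : 𝕜 => NormedSpace.exp (u • B) x)
      ((NormedSpace.exp ((t : 𝕜) • B) * B) x) (t : 𝕜) :=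
    ((ContinuousLinearMap.apply 𝕜 E x).hasFDerivAt.comp_hasDerivAt _ h1)
  have h3 : HasDerivAt (fun s : ℝ => (s : 𝕜)) 1 t := by
    simpa using (RCLike.ofRealCLM (K := 𝕜)).hasDerivAt (x := t)
  have h4 := HasDerivAt.scomp t h2 h3
  simpa [Function.comp_def, expGroup] using h4

/-- The derivative of the path `s ↦ exp (s (B - C)) exp (t C) x` equals `exp (s B) exp ((t - s) C)
(B - C) x`, hence is bounded by `‖B x - C x‖`. The bound involves no operator norm, so it survives
for approximations of an unbounded operator. -/
theorem norm_expGroup_sub_le {B C : E →L[𝕜] E} (h : Commute B C)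
    (hB : ∀ t : ℝ, 0 ≤ t → ∀ x, ‖expGroup B t x‖ ≤ ‖x‖)
    (hC : ∀ t : ℝ, 0 ≤ t → ∀ x, ‖expGroup C t x‖ ≤ ‖x‖) {t : ℝ} (ht : 0 ≤ t) (x : E) :
    ‖expGroup B t x - expGroup C t x‖ ≤ t * ‖B x - C x‖ := by
  have hder : ∀ s ∈ Icc (0 : ℝ) t, HasDerivWithinAt
      (fun s : ℝ => expGroup (B - C) s (expGroup C t x))
      (expGroup (B - C) s ((B - C) (expGroup C t x))) (Icc 0 t) s :=
    fun s _ => (hasDerivAt_expGroup_apply _ _ _).hasDerivWithinAt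
  have hbd : ∀ s ∈ Ico (0 : ℝ) t,
      ‖expGroup (B - C) s ((B - C) (expGroup C t x))‖ ≤ ‖B x - C x‖ := by
    intro s hs
    have hc : (B - C) (expGroup C t x) = expGroup C t ((B - C) x) := by
      have := (commute_expGroup (h.symm.sub_right (Commute.refl C)) t).eq
      exact congrArg (fun T : E →L[𝕜] E => T x) this
    have e : expGroup (B - C) s ((B - C) (expGroup C t x)) =
        expGroup B s (expGroup C (t - s) ((B - C) x)) := by
      rw [hc]
      exact (congrArg (fun T : E →L[𝕜] E => T ((B - C) x))
        (expGroup_eq_mul_of_commute h s t)).symm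
    rw [e]
    exact (hB s hs.1 _).trans (hC _ (by linarith [hs.2]) _)
  have := norm_image_sub_le_of_norm_deriv_le_segment' hder hbd t ⟨ht, le_rfl⟩
  have e1 : expGroup (B - C) t (expGroup C t x) = expGroup B t x := by
    have := expGroup_eq_mul_of_commute h t t
    rw [sub_self, expGroup_zero, mul_one] at this
    exact (congrArg (fun T : E →L[𝕜] E => T x) this).symm
  rw [expGroup_zero, e1] at this
  simpa [mul_comm] using this

theorem norm_expGroup_sub_self_le {B : E →L[𝕜] E}
    (hB : ∀ t : ℝ, 0 ≤ t → ∀ x, ‖expGroup B t x‖ ≤ ‖x‖) {t : ℝ} (ht : 0 ≤ t) (x : E) :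
    ‖expGroup B t x - x‖ ≤ t * ‖B x‖ := by
  have h0 : ∀ t : ℝ, expGroup (0 : E →L[𝕜] E) t = 1 := by
    intro t; simp [expGroup, NormedSpace.exp_zero]
  have := norm_expGroup_sub_le (Commute.zero_right B) hB (fun t _ x => by simp [h0]) ht x
  simpa [h0] using this

/-- The obvious remainder bound contains `B (B x)`, which has no limit when `B` approximates an
unbounded operator. Replacing `B x` by a nearby `z`, later taken in the domain, costs `2 ‖B x - z‖`.
-/
theorem norm_expGroup_taylor_le {B : E →L[𝕜] E}
    (hB : ∀ t : ℝ, 0 ≤ t → ∀ x, ‖expGroup B t x‖ ≤ ‖x‖) {t : ℝ} (ht : 0 ≤ t) (x z : E) :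
    ‖expGroup B t x - x - t • B x‖ ≤ t * (2 * ‖B x - z‖ + t * ‖B z‖) := by
  have hder : ∀ s ∈ Icc (0 : ℝ) t, HasDerivWithinAt
      (fun s : ℝ => expGroup B s x - s • B x) (expGroup B s (B x) - B x) (Icc 0 t) s := by
    intro s _
    refine HasDerivAt.hasDerivWithinAt ?_
    have := (hasDerivAt_expGroup_apply B x s).sub ((hasDerivAt_id s).smul_const (B x))
    simpa using! this
  have hbd : ∀ s ∈ Ico (0 : ℝ) t,
      ‖expGroup B s (B x) - B x‖ ≤ 2 * ‖B x - z‖ + t * ‖B z‖ := by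
    intro s hs
    have e : expGroup B s (B x) - B x
        = expGroup B s (B x - z) + (expGroup B s z - z) + (z - B x) := by
      rw [map_sub]; abel
    rw [e]
    have h1 := hB s hs.1 (B x - z)
    have h2 := norm_expGroup_sub_self_le hB hs.1 z
    have h3 : s * ‖B z‖ ≤ t * ‖B z‖ := mul_le_mul_of_nonneg_right hs.2.le (norm_nonneg _)
    have h4 : ‖z - B x‖ = ‖B x - z‖ := norm_sub_rev _ _
    have := norm_add₃_le (a := expGroup B s (B x - z)) (b := expGroup B s z - z) (c := z - B x)
    linarith
  have := norm_image_sub_le_of_norm_deriv_le_segment' hder hbd t ⟨ht, le_rfl⟩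
  simp only [expGroup_zero] at this
  have e : expGroup B t x - t • B x - ((1 : E →L[𝕜] E) x - (0 : ℝ) • B x)
      = expGroup B t x - x - t • B x := by
    simp; abel
  rw [e] at this
  linarith

end BoundedGenerator

/-! ### Dissipative bounded operators generate contractions. -/

section Hilbert

variable {𝕜 E : Type*} [RCLike 𝕜] [NormedAddCommGroup E] [InnerProductSpace 𝕜 E]

/-- The derivative of `‖exp (s B) x‖²` is `2 Re ⟨B y, y⟩` at `y = exp (s B) x`, so it is
nonpositive. -/
theorem norm_expGroup_le_of_dissipative [CompleteSpace E] {B : E →L[𝕜] E}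
    (hB : ∀ x, RCLike.re (inner 𝕜 (B x) x) ≤ 0) {t : ℝ} (ht : 0 ≤ t) (x : E) :
    ‖expGroup B t x‖ ≤ ‖x‖ := by
  let : NormedSpace ℝ E := NormedSpace.restrictScalars ℝ 𝕜 E
  have : IsScalarTower ℝ 𝕜 E := by infer_instance
  have hc : ∀ s : ℝ, expGroup B s (B x) = B (expGroup B s x) := fun s =>
    (congrArg (fun T : E →L[𝕜] E => T x) (commute_expGroup (Commute.refl B) s).eq).symm
  have hd : ∀ s : ℝ, HasDerivAt (fun s : ℝ => RCLike.re (inner 𝕜 (expGroup B s x) (expGroup B s x)))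
      (RCLike.re (inner 𝕜 (expGroup B s x) (expGroup B s (B x))
        + inner 𝕜 (expGroup B s (B x)) (expGroup B s x))) s := by
    intro s
    have h := (hasDerivAt_expGroup_apply B x s).inner 𝕜 (hasDerivAt_expGroup_apply B x s)
    exact (RCLike.reCLM (K := 𝕜)).hasFDerivAt.comp_hasDerivAt s h
  have hanti : Antitone (fun s : ℝ => RCLike.re (inner 𝕜 (expGroup B s x) (expGroup B s x))) := by
    refine antitone_of_deriv_nonpos (fun s => (hd s).differentiableAt) fun s => ?_
    rw [(hd s).deriv, hc, map_add, inner_re_symm (𝕜 := 𝕜)]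
    linarith [hB (expGroup B s x)]
  have := hanti ht
  simp only [expGroup_zero, one_apply_eq_self, inner_self_eq_norm_sq] at this
  exact (sq_le_sq₀ (norm_nonneg _) (norm_nonneg _)).1 this

end Hilbert

/-! ### Construction of contraction semigroups -/

section Construction

variable {𝕜 E : Type*} [RCLike 𝕜] [NormedAddCommGroup E] [NormedSpace 𝕜 E] [CompleteSpace E]
  [NormedSpace ℝ E] [IsScalarTower ℝ 𝕜 E]

/-- On the domain, differences of exponentials are controlled by differences of `J n z`, which
converges; the contraction property extends this to all `x` by density. -/
theorem cauchySeq_expGroup {J : ℕ → E →L[𝕜] E} (hcomm : ∀ m n, Commute (J m) (J n))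
    (hJ : ∀ n, ∀ t : ℝ, 0 ≤ t → ∀ x, ‖expGroup (J n) t x‖ ≤ ‖x‖) {A : E →ₗ.[𝕜] E}
    (hdense : Dense (A.domain : Set E))
    (hlim : ∀ x : A.domain, Tendsto (fun n => J n x) atTop (𝓝 (A x)))
    {t : ℝ} (ht : 0 ≤ t) (x : E) : CauchySeq fun n => expGroup (J n) t x := by
  rw [Metric.cauchySeq_iff']
  intro ε hε
  obtain ⟨z, hz, hzx⟩ := Metric.dense_iff.1 hdense x (ε / 4) (by positivity)
  rw [Metric.mem_ball, dist_eq_norm] at hz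
  have hc : CauchySeq fun n => J n z := (hlim ⟨z, hzx⟩).cauchySeq
  obtain ⟨N, hN⟩ := Metric.cauchySeq_iff'.1 hc (ε / (4 * (t + 1))) (by positivity)
  refine ⟨N, fun n hn => ?_⟩
  have h1 := norm_expGroup_sub_le (hcomm n N) (hJ n) (hJ N) ht z
  have h2 : ‖J n z - J N z‖ ≤ ε / (4 * (t + 1)) := by
    rw [← dist_eq_norm]; exact (hN n hn).le
  have h3 : t * ‖J n z - J N z‖ ≤ ε / 4 := by
    calc t * ‖J n z - J N z‖ ≤ (t + 1) * (ε / (4 * (t + 1))) := by gcongr; linarith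
      _ = ε / 4 := by field_simp
  have h4 := hJ n t ht (x - z)
  have h5 := hJ N t ht (z - x)
  have e : expGroup (J n) t x - expGroup (J N) t x = expGroup (J n) t (x - z)
      + (expGroup (J n) t z - expGroup (J N) t z) + expGroup (J N) t (z - x) := by
    simp only [map_sub]; abel
  rw [dist_eq_norm, e]
  have h6 := norm_add₃_le (a := expGroup (J n) t (x - z))
    (b := expGroup (J n) t z - expGroup (J N) t z) (c := expGroup (J N) t (z - x))
  rw [norm_sub_rev] at h4
  linarith

theorem exists_contractionSemigroup_of_tendsto {J : ℕ → E →L[𝕜] E}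
    (hcomm : ∀ m n, Commute (J m) (J n))
    (hJ : ∀ n, ∀ t : ℝ, 0 ≤ t → ∀ x, ‖expGroup (J n) t x‖ ≤ ‖x‖) {A : E →ₗ.[𝕜] E}
    (hdense : Dense (A.domain : Set E))
    (hlim : ∀ x : A.domain, Tendsto (fun n => J n x) atTop (𝓝 (A x))) :
    ∃ T : ℝ≥0 → E →ₗ[𝕜] E, IsContractionSemigroup (fun x : E => ‖x‖) T ∧
      ∀ x : A.domain, Tendsto (fun t : ℝ≥0 =>
        ‖(((t : ℝ)⁻¹ : ℝ) : 𝕜) • (T t x - x) - A x‖) (𝓝[>] 0) (𝓝 0) := by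
  choose L hL using fun (t : ℝ≥0) (x : E) =>
    cauchySeq_tendsto_of_complete (cauchySeq_expGroup hcomm hJ hdense hlim t.2 x)
  let T : ℝ≥0 → E →ₗ[𝕜] E := fun t =>
    { toFun := L t
      map_add' := fun x y => tendsto_nhds_unique (hL t (x + y))
        (by simpa only [map_add] using (hL t x).add (hL t y))
      map_smul' := fun c x => tendsto_nhds_unique (hL t (c • x))
        (by simpa only [map_smul, RingHom.id_apply] using (hL t x).const_smul c) }
  have hT : ∀ (t : ℝ≥0) x, Tendsto (fun n => expGroup (J n) (t : ℝ) x) atTop (𝓝 (T t x)) := hL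
  have hcontr : ∀ t x, ‖T t x‖ ≤ ‖x‖ := fun t x =>
    le_of_tendsto (hT t x).norm (Eventually.of_forall fun n => hJ n t t.2 x)
  have hlip : ∀ (t : ℝ≥0) (z : A.domain), ‖T t z - z‖ ≤ t * ‖A z‖ := fun t z =>
    le_of_tendsto_of_tendsto ((hT t z).sub_const (z : E)).norm ((hlim z).norm.const_mul (t : ℝ))
      (Eventually.of_forall fun n => norm_expGroup_sub_self_le (hJ n) t.2 z)
  refine ⟨T, ⟨?_, ?_, ?_, hcontr⟩, ?_⟩
  · ext x
    refine tendsto_nhds_unique (hT 0 x) ?_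
    simp [expGroup_zero]
  · intro s t
    ext x
    refine tendsto_nhds_unique (hT (s + t) x) ?_
    have h1 : Tendsto (fun n => expGroup (J n) (s : ℝ) (expGroup (J n) (t : ℝ) x - T t x))
        atTop (𝓝 0) := by
      refine squeeze_zero_norm (fun n => hJ n s s.2 _) ?_
      simpa using ((hT t x).sub_const (T t x)).norm
    have h2 := h1.add (hT s (T t x))
    simp only [map_sub, sub_add_cancel, zero_add] at h2
    refine h2.congr fun n => ?_
    rw [NNReal.coe_add, expGroup_add]
    rfl
  · intro x
    rw [Metric.tendsto_nhds]
    intro ε hε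
    obtain ⟨z, hz, hzx⟩ := Metric.dense_iff.1 hdense x (ε / 4) (by positivity)
    rw [Metric.mem_ball, dist_eq_norm] at hz
    have h0 : Tendsto (fun t : ℝ≥0 => (t : ℝ) * ‖A ⟨z, hzx⟩‖) (𝓝 0) (𝓝 0) := by
      have : Continuous fun t : ℝ≥0 => (t : ℝ) * ‖A ⟨z, hzx⟩‖ := by fun_prop
      simpa using this.tendsto 0
    filter_upwards [h0.eventually (gt_mem_nhds (show 0 < ε / 4 by positivity))] with t ht
    have h1 := hlip t ⟨z, hzx⟩
    have h2 := hcontr t (x - z)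
    have e : T t x - x = T t (x - z) + (T t z - z) + (z - x) := by rw [map_sub]; abel
    have h3 := norm_add₃_le (a := T t (x - z)) (b := T t z - z) (c := z - x)
    rw [norm_sub_rev x z] at h2
    simp only [dist_zero_right, norm_norm]
    rw [e]
    simp only at h1
    linarith
  · intro x
    -- The Taylor estimate passes to the limit because `x` and `z` both lie in the domain; `A x`
    -- itself need not.
    have hkey : ∀ (t : ℝ≥0) (z : A.domain),
        ‖T t x - x - (t : ℝ) • A x‖ ≤ t * (2 * ‖A x - z‖ + t * ‖A z‖) := fun t z => by
      refine le_of_tendsto_of_tendsto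
        (((hT t x).sub_const (x : E)).sub ((hlim x).const_smul (t : ℝ))).norm
        (((((hlim x).sub_const (z : E)).norm.const_mul 2).add
          ((hlim z).norm.const_mul (t : ℝ))).const_mul (t : ℝ))
        (Eventually.of_forall fun n => norm_expGroup_taylor_le (hJ n) t.2 x z)
    rw [Metric.tendsto_nhds]
    intro ε hε
    obtain ⟨z, hz, hzx⟩ := Metric.dense_iff.1 hdense (A x) (ε / 4) (by positivity)
    rw [Metric.mem_ball, dist_eq_norm, norm_sub_rev] at hz
    have h0 : Tendsto (fun t : ℝ≥0 => (t : ℝ) * ‖A ⟨z, hzx⟩‖) (𝓝[>] 0) (𝓝 0) := by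
      have : Continuous fun t : ℝ≥0 => (t : ℝ) * ‖A ⟨z, hzx⟩‖ := by fun_prop
      simpa using (this.tendsto 0).mono_left nhdsWithin_le_nhds
    filter_upwards [h0.eventually (gt_mem_nhds (show 0 < ε / 4 by positivity)),
      self_mem_nhdsWithin] with t ht ht0
    have htr : (0 : ℝ) < t := ht0
    have h1 := hkey t ⟨z, hzx⟩
    have e : (((t : ℝ)⁻¹ : ℝ) : 𝕜) • (T t x - x) - A x
        = (((t : ℝ)⁻¹ : ℝ) : 𝕜) • (T t x - x - (t : ℝ) • A x) := by
      rw [smul_sub _ (T t x - x), ← algebraMap_smul 𝕜 (t : ℝ) (A x), smul_smul]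
      rw [RCLike.algebraMap_eq_ofReal, ← RCLike.ofReal_mul, inv_mul_cancel₀ htr.ne']
      simp
    rw [e]
    simp only [dist_zero_right, norm_norm]
    rw [norm_smul, RCLike.norm_ofReal, abs_of_pos (inv_pos.2 htr)]
    rw [inv_mul_lt_iff₀ htr]
    refine h1.trans_lt ?_
    gcongr
    simp only
    linarith

end Construction

/-! ### The Lumer–Phillips theorem -/

section LumerPhillips

variable {𝕜 E : Type*} [RCLike 𝕜] [NormedAddCommGroup E] [InnerProductSpace 𝕜 E]

theorem IsDissipative.mul_norm_le {A : E →ₗ.[𝕜] E} (hA : IsDissipative A) (l : ℝ)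
    (x : A.domain) : l * ‖(x : E)‖ ≤ ‖(l : 𝕜) • (x : E) - A x‖ := by
  have h1 : l * ‖(x : E)‖ ^ 2 ≤ RCLike.re (inner 𝕜 ((l : 𝕜) • (x : E) - A x) (x : E)) := by
    rw [inner_sub_left, inner_smul_left, map_sub, RCLike.conj_ofReal, RCLike.re_ofReal_mul,
      inner_self_eq_norm_sq]
    linarith [hA x]
  have h2 := (RCLike.re_le_norm _).trans
    (norm_inner_le_norm (𝕜 := 𝕜) ((l : 𝕜) • (x : E) - A x) (x : E))
  rcases (norm_nonneg (x : E)).eq_or_lt with h | h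
  · rw [← h]; simp
  · refine le_of_mul_le_mul_right ?_ h
    calc l * ‖(x : E)‖ * ‖(x : E)‖ = l * ‖(x : E)‖ ^ 2 := by ring
      _ ≤ _ := h1.trans h2

/-- The resolvent of a dissipative operator `A` for which `l - A` is surjective. -/
theorem IsDissipative.exists_resolvent {A : E →ₗ.[𝕜] E} (hA : IsDissipative A) {l : ℝ}
    (hl : 0 < l) (hr : ∀ y : E, ∃ x : A.domain, (l : 𝕜) • (x : E) - A x = y) :
    ∃ R : E →L[𝕜] E, (∀ y, l * ‖R y‖ ≤ ‖y‖) ∧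
      (∀ y, ∃ h : R y ∈ A.domain, (l : 𝕜) • R y - A ⟨R y, h⟩ = y) ∧
      ∀ x : A.domain, R ((l : 𝕜) • (x : E) - A x) = x := by
  let F : A.domain →ₗ[𝕜] E := (l : 𝕜) • A.domain.subtype - A.toFun
  have hF : ∀ x, F x = (l : 𝕜) • (x : E) - A x := fun x => rfl
  have hinj : Function.Injective F := by
    rw [injective_iff_map_eq_zero]
    intro x hx
    have := hA.mul_norm_le l x
    rw [← hF, hx, norm_zero] at this
    have h0 : ‖(x : E)‖ = 0 := le_antisymm (by nlinarith) (norm_nonneg _)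
    exact Subtype.ext (norm_eq_zero.1 h0)
  let e := LinearEquiv.ofBijective F ⟨hinj, fun y => hr y⟩
  have he : ∀ y, F (e.symm y) = y := fun y => e.apply_symm_apply y
  have hb : ∀ y, l * ‖(e.symm y : E)‖ ≤ ‖y‖ := by
    intro y
    have := hA.mul_norm_le l (e.symm y)
    rwa [← hF, he] at this
  refine ⟨(A.domain.subtype ∘ₗ e.symm.toLinearMap).mkContinuous l⁻¹ fun y => ?_, hb, ?_, ?_⟩
  · rw [inv_mul_eq_div, le_div_iff₀ hl, mul_comm]
    exact hb y
  · exact fun y => ⟨(e.symm y).2, he y⟩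
  · intro x
    exact congrArg Subtype.val (e.symm_apply_apply x)

/-- If `z = l x - A x` is orthogonal to the domain, pairing it with `x` gives `l ‖x‖² = Re ⟨A x, x⟩
≤ 0`, so `x = 0` and `z = 0`. -/
theorem IsDissipative.dense_domain [CompleteSpace E] {A : E →ₗ.[𝕜] E} (hA : IsDissipative A)
    {l : ℝ} (hl : 0 < l) (hr : ∀ y : E, ∃ x : A.domain, (l : 𝕜) • (x : E) - A x = y) :
    Dense (A.domain : Set E) := by
  rw [Submodule.dense_iff_topologicalClosure_eq_top, Submodule.topologicalClosure_eq_top_iff,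
    Submodule.eq_bot_iff]
  intro z hz
  obtain ⟨x, rfl⟩ := hr z
  have h0 := (Submodule.mem_orthogonal' _ _).1 hz x x.2
  rw [inner_sub_left, inner_smul_left, RCLike.conj_ofReal] at h0
  have h1 := congrArg RCLike.re h0
  rw [map_sub, RCLike.re_ofReal_mul, inner_self_eq_norm_sq, map_zero] at h1
  have h2 : ‖(x : E)‖ = 0 := by
    have := hA x
    have h3 : l * ‖(x : E)‖ ^ 2 ≤ 0 := by linarith
    have h4 : ‖(x : E)‖ ^ 2 ≤ 0 := by
      by_contra h
      push Not at h
      exact absurd h3 (not_le.2 (mul_pos hl h))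
    exact pow_eq_zero_iff two_ne_zero |>.1 (le_antisymm h4 (sq_nonneg _))
  have h3 : x = 0 := Subtype.ext (norm_eq_zero.1 h2)
  simp [h3]

/-- Cauchy–Schwarz gives `Re ⟨T(t) x, x⟩ ≤ ‖x‖²`, so every difference quotient already has the right
sign. -/
theorem re_inner_generator_nonpos {T : ℝ≥0 → E →ₗ[𝕜] E}
    (hT : ∀ t x, ‖T t x‖ ≤ ‖x‖) {x y : E}
    (h : Tendsto (fun t : ℝ≥0 => ‖(((t : ℝ)⁻¹ : ℝ) : 𝕜) • (T t x - x) - y‖) (𝓝[>] 0) (𝓝 0)) :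
    RCLike.re (inner 𝕜 y x) ≤ 0 := by
  have h1 := tendsto_iff_norm_sub_tendsto_zero.2 h
  have h2 : Tendsto (fun t : ℝ≥0 => RCLike.re (inner 𝕜 ((((t : ℝ)⁻¹ : ℝ) : 𝕜) • (T t x - x)) x))
      (𝓝[>] 0) (𝓝 (RCLike.re (inner 𝕜 y x))) :=
    (RCLike.continuous_re.tendsto _).comp (h1.inner tendsto_const_nhds)
  refine le_of_tendsto h2 (Eventually.of_forall fun t => ?_)
  rw [inner_smul_left, RCLike.conj_ofReal, RCLike.re_ofReal_mul, inner_sub_left, map_sub,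
    inner_self_eq_norm_sq]
  refine mul_nonpos_of_nonneg_of_nonpos (inv_nonneg.2 t.2) ?_
  have h3 := (RCLike.re_le_norm _).trans (norm_inner_le_norm (𝕜 := 𝕜) (T t x) x)
  nlinarith [hT t x, norm_nonneg x]

theorem GeneratesContractionSemigroup.isDissipative {A : E →ₗ.[𝕜] E}
    (hA : GeneratesContractionSemigroup (fun x : E => ‖x‖) A) : IsDissipative A := by
  obtain ⟨T, hT, hG⟩ := hA
  exact fun x => re_inner_generator_nonpos hT.contraction ((hG x (A x)).1 ⟨x.2, rfl⟩)

/-- For `z` in the domain, `l R z - z = R (A z)` has norm at most `‖A z‖ / l`; density and `‖l R‖ ≤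
1` do the rest. -/
theorem tendsto_smul_resolvent {A : E →ₗ.[𝕜] E} (hdense : Dense (A.domain : Set E))
    {l : ℕ → ℝ} (hl : ∀ n, 0 < l n) (hlim : Tendsto l atTop atTop) {R : ℕ → E →L[𝕜] E}
    (hR : ∀ n y, l n * ‖R n y‖ ≤ ‖y‖)
    (hRA : ∀ n (x : A.domain), R n ((l n : 𝕜) • (x : E) - A x) = x) (x : E) :
    Tendsto (fun n => (l n : 𝕜) • R n x) atTop (𝓝 x) := by
  rw [Metric.tendsto_nhds]
  intro ε hε
  obtain ⟨z, hz, hzx⟩ := Metric.dense_iff.1 hdense x (ε / 4) (by positivity)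
  rw [Metric.mem_ball, dist_eq_norm] at hz
  have h0 : Tendsto (fun n => ‖A ⟨z, hzx⟩‖ / l n) atTop (𝓝 0) := hlim.const_div_atTop _
  filter_upwards [h0.eventually (gt_mem_nhds (show 0 < ε / 4 by positivity))] with n hn
  have h1 : ‖(l n : 𝕜) • R n (x - z)‖ ≤ ‖x - z‖ := by
    rw [norm_smul, RCLike.norm_ofReal, abs_of_pos (hl n)]
    exact hR n _
  have h2 : (l n : 𝕜) • R n z - z = R n (A ⟨z, hzx⟩) := by
    have := hRA n ⟨z, hzx⟩
    rw [map_sub, map_smul] at this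
    rw [sub_eq_iff_eq_add, add_comm, ← sub_eq_iff_eq_add]
    exact this
  have h3 : ‖R n (A ⟨z, hzx⟩)‖ ≤ ‖A ⟨z, hzx⟩‖ / l n := by
    rw [le_div_iff₀ (hl n), mul_comm]
    exact hR n _
  have e : (l n : 𝕜) • R n x - x
      = (l n : 𝕜) • R n (x - z) + ((l n : 𝕜) • R n z - z) + (z - x) := by
    rw [map_sub, smul_sub]; abel
  have h4 := norm_add₃_le (a := (l n : 𝕜) • R n (x - z)) (b := (l n : 𝕜) • R n z - z)
    (c := z - x)
  rw [norm_sub_rev x z] at h1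
  rw [dist_eq_norm, e]
  rw [h2] at h4 ⊢
  linarith

/-- The **Lumer–Phillips theorem**. -/
theorem IsDissipative.generatesContractionSemigroup [CompleteSpace E] {A : E →ₗ.[𝕜] E}
    (hA : IsDissipative A)
    (hr : ∀ l : ℝ, 0 < l → ∀ y : E, ∃ x : A.domain, (l : 𝕜) • (x : E) - A x = y) :
    GeneratesContractionSemigroup (fun x : E => ‖x‖) A := by
  let : NormedSpace ℝ E := NormedSpace.restrictScalars ℝ 𝕜 E
  have : IsScalarTower ℝ 𝕜 E := by infer_instance
  have hdense := hA.dense_domain one_pos (hr 1 one_pos)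
  let l : ℕ → ℝ := fun n => n + 1
  have hl : ∀ n, 0 < l n := fun n => by positivity
  have hlim : Tendsto l atTop atTop :=
    tendsto_atTop_add_const_right _ _ tendsto_natCast_atTop_atTop
  choose R hR hAR hRA using fun n => hA.exists_resolvent (hl n) (hr (l n) (hl n))
  -- The resolvent identity. Exchanging `m` and `n` in it shows that the resolvents commute, since
  -- `l n ≠ l m` for `m ≠ n`.
  have hres : ∀ m n y, R n y + ((l n : 𝕜) - l m) • R n (R m y) = R m y := by
    intro m n y
    obtain ⟨h, e⟩ := hAR m y
    have h1 := hRA n ⟨R m y, h⟩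
    have h2 : A ⟨R m y, h⟩ = (l m : 𝕜) • R m y - y := by 
      rw [eq_sub_iff_add_eq']; exact (sub_eq_iff_eq_add.1 e).symm
    rw [h2] at h1
    simp only [map_sub, map_smul] at h1
    rw [sub_smul]
    refine Eq.trans ?_ h1
    abel
  have hRcomm : ∀ m n, Commute (R m) (R n) := by
    intro m n
    rcases eq_or_ne m n with rfl | hmn
    · exact Commute.refl _
    · refine ContinuousLinearMap.ext fun y => ?_
      have h1 := hres n m y
      have h2 := hres m n y
      have hne : (l n : 𝕜) - l m ≠ 0 := by
        rw [sub_ne_zero]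
        intro h
        exact hmn (by simpa [l] using h.symm)
      have h3 : ((l n : 𝕜) - l m) • R m (R n y) = ((l n : 𝕜) - l m) • R n (R m y) := by
        rw [← eq_sub_iff_add_eq'] at h1 h2
        rw [h2, ← neg_sub (l m : 𝕜), neg_smul, h1]
        abel
      exact smul_right_injective E hne h3
  -- The Yosida approximations `l² R - l = l A R`, which equal `l R A` on the domain and so converge
  -- to `A` there.
  let J : ℕ → E →L[𝕜] E := fun n => (l n : 𝕜) ^ 2 • R n - (l n : 𝕜) • 1
  have hJcomm : ∀ m n, Commute (J m) (J n) := fun m n => by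
    have h1 : Commute (R m) (J n) :=
      ((hRcomm m n).smul_right _).sub_right ((Commute.one_right _).smul_right _)
    exact (h1.smul_left _).sub_left ((Commute.one_left _).smul_left _)
  have hJR : ∀ n x, J n x = (l n : 𝕜) • ((l n : 𝕜) • R n x - x) := fun n x => by
    rw [smul_sub, smul_smul, ← sq]
    rfl
  have hJA : ∀ n (x : A.domain), J n x = (l n : 𝕜) • R n (A x) := by
    intro n x
    have h1 := hRA n x
    simp only [map_sub, map_smul] at h1
    rw [hJR, sub_eq_iff_eq_add.1 h1, add_sub_cancel_left]
  have hJdiss : ∀ n x, RCLike.re (inner 𝕜 (J n x) x) ≤ 0 := by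
    intro n x
    obtain ⟨h, e⟩ := hAR n x
    have h1 : J n x = (l n : 𝕜) • A ⟨R n x, h⟩ := by
      rw [hJR, sub_eq_iff_eq_add.1 e, add_sub_cancel_left]
    have h3 := hA ⟨R n x, h⟩
    rw [h1, inner_smul_left, RCLike.conj_ofReal, RCLike.re_ofReal_mul]
    refine mul_nonpos_of_nonneg_of_nonpos (hl n).le ?_
    -- Writing `x = l R x - A R x` in the second slot leaves `l Re ⟨A R x, R x⟩ - ‖A R x‖²`, a sum
    -- of two nonpositive terms.
    nth_rewrite 2 [← e]
    rw [inner_sub_right, inner_smul_right, map_sub, RCLike.re_ofReal_mul, inner_self_eq_norm_sq]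
    have := mul_nonpos_of_nonneg_of_nonpos (hl n).le h3
    have := sq_nonneg ‖A ⟨R n x, h⟩‖
    simp only at *
    linarith
  obtain ⟨T, hT, hTA⟩ := exists_contractionSemigroup_of_tendsto hJcomm
    (fun n t ht x => norm_expGroup_le_of_dissipative (hJdiss n) ht x) hdense
    (fun x => by
      simp only [hJA]
      exact tendsto_smul_resolvent hdense hl hlim hR hRA (A x))
  refine ⟨T, hT, fun x y => ⟨?_, fun hxy => ?_⟩⟩
  · rintro ⟨hx, rfl⟩
    exact hTA ⟨x, hx⟩
  -- The generator has no larger domain than `A`: with `z - A z = x - y`, the vector `x - z` is an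
  -- eigenvector of the generator for the eigenvalue `1` unless it is zero, and dissipativity
  -- excludes the former.
  · obtain ⟨z, hz⟩ := hr 1 one_pos (x - y)
    rw [RCLike.ofReal_one, one_smul] at hz
    have h1 := tendsto_iff_norm_sub_tendsto_zero.2 hxy
    have h2 := tendsto_iff_norm_sub_tendsto_zero.2 (hTA z)
    have hyz : y - A z = x - z := by
      have : A z = z - (x - y) := by rw [← hz]; abel
      rw [this]; abel
    have h3 := h1.sub h2
    rw [hyz] at h3
    have h4 := re_inner_generator_nonpos (𝕜 := 𝕜) hT.contraction (x := x - z) (y := x - z) (by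
      refine tendsto_iff_norm_sub_tendsto_zero.1 (h3.congr fun t => ?_)
      rw [← smul_sub, map_sub]
      congr 1
      abel)
    rw [inner_self_eq_norm_sq] at h4
    have h5 : x - z = 0 := norm_eq_zero.1
      (pow_eq_zero_iff two_ne_zero |>.1 (le_antisymm h4 (sq_nonneg _)))
    have h6 : x = z := sub_eq_zero.1 h5
    refine ⟨h6 ▸ z.2, ?_⟩
    have h7 : (⟨x, h6 ▸ z.2⟩ : A.domain) = z := Subtype.ext h6
    rw [h7]
    rw [h5] at hyz
    exact (sub_eq_zero.1 hyz).symm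

end LumerPhillips

/-! ### Change of the inner product -/

section Core

variable {𝕜 E : Type*} [RCLike 𝕜] [AddCommGroup E] [Module 𝕜 E]

/-- The Lumer–Phillips theorem for an inner product on a space without a given norm. -/
theorem generatesContractionSemigroup_of_core (c : InnerProductSpace.Core 𝕜 E)
    (hc : ∀ u : ℕ → E, (∀ ε > 0, ∃ N, ∀ n ≥ N, √(RCLike.re (c.inner (u n - u N) (u n - u N))) < ε) →
      ∃ x, Tendsto (fun n => √(RCLike.re (c.inner (u n - x) (u n - x)))) atTop (𝓝 0))
    (A : E →ₗ.[𝕜] E) (hA : ∀ x : A.domain, RCLike.re (c.inner (A x) x) ≤ 0)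
    (hr : ∀ l : ℝ, 0 < l → ∀ y : E, ∃ x : A.domain, (l : 𝕜) • (x : E) - A x = y) :
    GeneratesContractionSemigroup (fun x : E => √(RCLike.re (c.inner x x))) A := by
  let : NormedAddCommGroup E := c.toNormedAddCommGroup
  let : InnerProductSpace 𝕜 E := InnerProductSpace.ofCore c.toCore
  have : CompleteSpace E := by
    refine Metric.complete_of_cauchySeq_tendsto fun u hu => ?_
    obtain ⟨x, hx⟩ := hc u fun ε hε => by
      obtain ⟨N, hN⟩ := Metric.cauchySeq_iff'.1 hu ε hε
      exact ⟨N, fun n hn => (dist_eq_norm (u n) (u N)).symm.trans_lt (hN n hn)⟩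
    exact ⟨x, tendsto_iff_norm_sub_tendsto_zero.2 hx⟩
  exact IsDissipative.generatesContractionSemigroup (E := E) (A := A) hA hr

theorem re_inner_nonpos_of_generates (c : InnerProductSpace.Core 𝕜 E) (A : E →ₗ.[𝕜] E)
    (hA : GeneratesContractionSemigroup (fun x : E => √(RCLike.re (c.inner x x))) A)
    (x : A.domain) : RCLike.re (c.inner (A x) x) ≤ 0 := by
  let : NormedAddCommGroup E := c.toNormedAddCommGroup
  let : InnerProductSpace 𝕜 E := InnerProductSpace.ofCore c.toCore
  exact GeneratesContractionSemigroup.isDissipative (E := E) (A := A) hA x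

end Core

/-! ### Equivalent inner products `⟨x, G y⟩` on a Hilbert space. -/

section Energy

variable {𝕜 E : Type*} [RCLike 𝕜] [NormedAddCommGroup E] [InnerProductSpace 𝕜 E]
  [CompleteSpace E]

theorem exists_bound_of_isSymmetric {G : E →ₗ[𝕜] E} (hG : G.IsSymmetric) :
    ∃ C, 0 ≤ C ∧ ∀ x, ‖G x‖ ≤ C * ‖x‖ :=
  ⟨‖(⟨G, hG.continuous⟩ : E →L[𝕜] E)‖, norm_nonneg _,
    (⟨G, hG.continuous⟩ : E →L[𝕜] E).le_opNorm⟩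

/-- A symmetric operator on a Hilbert space that is positive and has a symmetric inverse. -/
structure IsPositiveIso (G K : E →ₗ[𝕜] E) : Prop where
  isSymmetric : G.IsSymmetric
  nonneg : ∀ x, 0 ≤ RCLike.re (inner 𝕜 x (G x))
  isSymmetric_inv : K.IsSymmetric
  left_inv : ∀ x, K (G x) = x
  right_inv : ∀ x, G (K x) = x

namespace IsPositiveIso

variable {G K : E →ₗ[𝕜] E}

/-- Cauchy–Schwarz for the form `⟨x, G y⟩`, applied to `x` and `K x`, reads `‖x‖⁴ ≤ ⟨x, G x⟩ ⟨K x,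
x⟩`. The last factor is at most `C ‖x‖²`, because the symmetric operator `K`, being everywhere
defined, is bounded. -/
theorem exists_coercive (h : IsPositiveIso G K) :
    ∃ C, 0 ≤ C ∧ ∀ x, ‖x‖ ^ 2 ≤ C * RCLike.re (inner 𝕜 x (G x)) := by
  obtain ⟨C, hC0, hC⟩ := exists_bound_of_isSymmetric h.isSymmetric_inv
  refine ⟨C, hC0, fun x => ?_⟩
  let c : PreInnerProductSpace.Core 𝕜 E :=
    { inner := fun x y => inner 𝕜 x (G y)
      conj_inner_symm := fun x y => by rw [inner_conj_symm, h.isSymmetric x y]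
      re_inner_nonneg := h.nonneg
      add_left := fun x y z => inner_add_left _ _ _
      smul_left := fun x y r => inner_smul_left _ _ _ }
  have h1 : ‖inner 𝕜 x (G (K x))‖ * ‖inner 𝕜 (K x) (G x)‖
      ≤ RCLike.re (inner 𝕜 x (G x)) * RCLike.re (inner 𝕜 (K x) (G (K x))) :=
    InnerProductSpace.Core.inner_mul_inner_self_le (c := c) x (K x)
  rw [h.isSymmetric_inv, h.left_inv, h.right_inv, inner_self_eq_norm_sq_to_K] at h1
  have h2 : RCLike.re (inner 𝕜 (K x) x) ≤ C * ‖x‖ * ‖x‖ :=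
    (RCLike.re_le_norm _).trans ((norm_inner_le_norm _ _).trans (by gcongr; exact hC x))
  have h3 : ‖((‖x‖ : ℝ) : 𝕜) ^ 2‖ = ‖x‖ ^ 2 := by
    rw [norm_pow, RCLike.norm_ofReal, abs_norm]
  rw [h3] at h1
  rcases (norm_nonneg x).eq_or_lt with h0 | h0
  · rw [← h0]
    have := mul_nonneg hC0 (h.nonneg x)
    simpa using this
  · refine le_of_mul_le_mul_right (h1.trans ?_) (pow_pos h0 2)
    calc _ ≤ RCLike.re (inner 𝕜 x (G x)) * (C * ‖x‖ * ‖x‖) :=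
          mul_le_mul_of_nonneg_left h2 (h.nonneg x)
      _ = _ := by ring

/-- The inner product `⟨x, G y⟩`. -/
@[reducible]
def core (h : IsPositiveIso G K) : InnerProductSpace.Core 𝕜 E where
  inner x y := inner 𝕜 x (G y)
  conj_inner_symm x y := by rw [inner_conj_symm, h.isSymmetric x y]
  re_inner_nonneg := h.nonneg
  add_left x y z := inner_add_left _ _ _
  smul_left x y r := inner_smul_left _ _ _
  definite x hx := by
    obtain ⟨C, -, hC⟩ := h.exists_coercive
    have := hC x
    rw [hx, map_zero, mul_zero] at this
    exact norm_eq_zero.1 (pow_eq_zero_iff two_ne_zero |>.1 (le_antisymm this (sq_nonneg _)))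

theorem generatesContractionSemigroup (h : IsPositiveIso G K) (A : E →ₗ.[𝕜] E)
    (hA : ∀ x : A.domain, RCLike.re (inner 𝕜 (A x) (G x)) ≤ 0)
    (hr : ∀ l : ℝ, 0 < l → ∀ y : E, ∃ x : A.domain, (l : 𝕜) • (x : E) - A x = y) :
    GeneratesContractionSemigroup (fun x : E => √(RCLike.re (inner 𝕜 x (G x)))) A := by
  refine generatesContractionSemigroup_of_core h.core (fun u hu => ?_) A hA hr
  obtain ⟨C, hC0, hC⟩ := h.exists_coercive
  obtain ⟨D, hD0, hD⟩ := exists_bound_of_isSymmetric h.isSymmetric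
  -- The two norms are equivalent, so completeness transfers.
  have hle : ∀ x : E, ‖x‖ ≤ √C * √(RCLike.re (inner 𝕜 x (G x))) := fun x => by
    rw [← Real.sqrt_mul hC0]
    exact Real.le_sqrt_of_sq_le (hC x)
  have hge : ∀ x : E, √(RCLike.re (inner 𝕜 x (G x))) ≤ √D * ‖x‖ := fun x => by
    rw [← Real.sqrt_sq (norm_nonneg x), ← Real.sqrt_mul hD0]
    refine Real.sqrt_le_sqrt ((RCLike.re_le_norm _).trans ((norm_inner_le_norm _ _).trans ?_))
    calc ‖x‖ * ‖G x‖ ≤ ‖x‖ * (D * ‖x‖) := by gcongr; exact hD x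
      _ = _ := by ring
  have hu' : CauchySeq u := by
    refine Metric.cauchySeq_iff'.2 fun ε hε => ?_
    obtain ⟨N, hN⟩ := hu (ε / (√C + 1)) (by positivity)
    refine ⟨N, fun n hn => ?_⟩
    rw [dist_eq_norm]
    calc ‖u n - u N‖ ≤ √C * √(RCLike.re (inner 𝕜 (u n - u N) (G (u n - u N)))) := hle _
      _ ≤ √C * (ε / (√C + 1)) := by gcongr; exact (hN n hn).le
      _ < (√C + 1) * (ε / (√C + 1)) := by gcongr; linarith
      _ = ε := by field_simp
  obtain ⟨x, hx⟩ := cauchySeq_tendsto_of_complete hu'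
  refine ⟨x, squeeze_zero (fun n => Real.sqrt_nonneg _) (fun n => hge _) ?_⟩
  simpa using (tendsto_iff_norm_sub_tendsto_zero.1 hx).const_mul (√D)

theorem re_inner_nonpos_of_generates (h : IsPositiveIso G K) (A : E →ₗ.[𝕜] E)
    (hA : GeneratesContractionSemigroup (fun x : E => √(RCLike.re (inner 𝕜 x (G x)))) A)
    (x : A.domain) : RCLike.re (inner 𝕜 (A x) (G x)) ≤ 0 :=
  PortHam.re_inner_nonpos_of_generates h.core A hA x

end IsPositiveIso

end Energy

/-! ### Integration by parts for primitives -/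

section IntegrationByParts

/-- The primitives are differentiable only a.e., but they are absolutely continuous, and that
suffices for the product rule in integrated form. -/
theorem integral_mul_primitive {v w : ℝ → ℝ} {a b T : ℝ} (hv : IntervalIntegrable v volume 0 T)
    (hw : IntervalIntegrable w volume 0 T) :
    ∫ t in (0 : ℝ)..T, (v t * (b + ∫ s in (0 : ℝ)..t, w s) + (a + ∫ s in (0 : ℝ)..t, v s) * w t)
      = (a + ∫ s in (0 : ℝ)..T, v s) * (b + ∫ s in (0 : ℝ)..T, w s) - a * b := by
  have hac : ∀ {v : ℝ → ℝ} (a : ℝ), IntervalIntegrable v volume 0 T →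
      AbsolutelyContinuousOnInterval (fun t => a + ∫ s in (0 : ℝ)..t, v s) 0 T := fun a hv =>
    (contDiffOn_const (c := a)).absolutelyContinuousOnInterval.fun_add
      (hv.absolutelyContinuousOnInterval_intervalIntegral left_mem_uIcc)
  have hd : ∀ {v : ℝ → ℝ} (a : ℝ), IntervalIntegrable v volume 0 T → ∀ᵐ t, t ∈ uIcc 0 T →
      deriv (fun t => a + ∫ s in (0 : ℝ)..t, v s) t = v t := fun a hv => by
    filter_upwards [hv.ae_hasDerivAt_integral] with t ht htT
    exact ((ht htT 0 left_mem_uIcc).const_add a).deriv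
  have h := (hac a hv).integral_deriv_mul_eq_sub (hac b hw)
  simp only [intervalIntegral.integral_same, add_zero] at h
  rw [← h]
  refine intervalIntegral.integral_congr_ae ?_
  filter_upwards [hd a hv, hd b hw] with t h1 h2 ht
  rw [h1 (uIoc_subset_uIcc ht), h2 (uIoc_subset_uIcc ht)]

variable {E : Type*} [NormedAddCommGroup E] [InnerProductSpace ℝ E]

theorem intervalIntegrable_const_inner {v : ℝ → E} {a b : ℝ} (hv : IntervalIntegrable v volume a b)
    (e : E) : IntervalIntegrable (fun t => inner ℝ e (v t)) volume a b :=
  ⟨hv.1.const_inner e, hv.2.const_inner e⟩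

theorem continuous_primitive {v : ℝ → E} (hv : LocallyIntegrable v volume) :
    Continuous fun t => ∫ s in (0 : ℝ)..t, v s :=
  intervalIntegral.continuous_primitive
    (fun _ _ => hv.integrableOn_isCompact isCompact_uIcc |>.intervalIntegrable) 0

variable [FiniteDimensional ℝ E]

theorem inner_intervalIntegral {v : ℝ → E} {a b : ℝ} (hv : IntervalIntegrable v volume a b)
    (e : E) : inner ℝ e (∫ t in a..b, v t) = ∫ t in a..b, inner ℝ e (v t) :=
  ((innerSL ℝ e).intervalIntegral_comp_comm hv).symm

theorem intervalIntegral_inner_primitive {v w : ℝ → E} (a b : E) (T : ℝ)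
    (hv : LocallyIntegrable v volume) (hw : LocallyIntegrable w volume) :
    ∫ t in (0 : ℝ)..T, (inner ℝ (v t) (b + ∫ s in (0 : ℝ)..t, w s)
        + inner ℝ (a + ∫ s in (0 : ℝ)..t, v s) (w t))
      = inner ℝ (a + ∫ s in (0 : ℝ)..T, v s) (b + ∫ s in (0 : ℝ)..T, w s) - inner ℝ a b := by
  have hvi : ∀ t, IntervalIntegrable v volume 0 t := fun t =>
    (hv.integrableOn_isCompact isCompact_uIcc).intervalIntegrable
  have hwi : ∀ t, IntervalIntegrable w volume 0 t := fun t =>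
    (hw.integrableOn_isCompact isCompact_uIcc).intervalIntegrable
  let e := stdOrthonormalBasis ℝ E
  have key : ∀ x y : E, inner ℝ x y = ∑ i, inner ℝ (e i) x * inner ℝ (e i) y := fun x y => by
    rw [← e.sum_inner_mul_inner x y]
    exact Finset.sum_congr rfl fun i _ => by rw [real_inner_comm]
  have hexp : ∀ t, inner ℝ (v t) (b + ∫ s in (0 : ℝ)..t, w s)
        + inner ℝ (a + ∫ s in (0 : ℝ)..t, v s) (w t)
      = ∑ i, (inner ℝ (e i) (v t) * (inner ℝ (e i) b + ∫ s in (0 : ℝ)..t, inner ℝ (e i) (w s))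
        + (inner ℝ (e i) a + ∫ s in (0 : ℝ)..t, inner ℝ (e i) (v s)) * inner ℝ (e i) (w t)) := by
    intro t
    rw [key, key, ← Finset.sum_add_distrib]
    refine Finset.sum_congr rfl fun i _ => ?_
    rw [inner_add_right, inner_add_right, inner_intervalIntegral (hvi t),
      inner_intervalIntegral (hwi t)]
  have hcont : ∀ {v : ℝ → E}, LocallyIntegrable v volume → ∀ (a : E) i, Continuous fun t =>
      inner ℝ (e i) a + ∫ s in (0 : ℝ)..t, inner ℝ (e i) (v s) := fun {v} hv a i => by
    have h := (continuous_const (y := a)).add (continuous_primitive hv)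
    have h2 : Continuous fun t => inner ℝ (e i) (a + ∫ s in (0 : ℝ)..t, v s) :=
      continuous_const.inner h
    refine h2.congr fun t => ?_
    rw [inner_add_right, inner_intervalIntegral
      ((hv.integrableOn_isCompact isCompact_uIcc).intervalIntegrable)]
  simp only [hexp]
  rw [intervalIntegral.integral_finsetSum]
  · rw [key, key a b, ← Finset.sum_sub_distrib]
    refine Finset.sum_congr rfl fun i _ => ?_
    rw [integral_mul_primitive (intervalIntegrable_const_inner (hvi T) _)
      (intervalIntegrable_const_inner (hwi T) _), inner_add_right, inner_add_right,
      inner_intervalIntegral (hvi T), inner_intervalIntegral (hwi T)]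
  · intro i _
    exact ((intervalIntegrable_const_inner (hvi T) _).mul_continuousOn
      (hcont hw b i).continuousOn).add ((intervalIntegrable_const_inner (hwi T) _).continuousOn_mul
      (hcont hv a i).continuousOn)

theorem integral_Ioi_inner_primitive {v w : ℝ → E} {a b : E} {l : ℝ}
    (hv : LocallyIntegrable v volume) (hw : LocallyIntegrable w volume)
    (hint : IntegrableOn (fun t => inner ℝ (v t) (b + ∫ s in (0 : ℝ)..t, w s)
        + inner ℝ (a + ∫ s in (0 : ℝ)..t, v s) (w t)) (Ioi 0))
    (hlim : Tendsto (fun t => inner ℝ (a + ∫ s in (0 : ℝ)..t, v s) (b + ∫ s in (0 : ℝ)..t, w s))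
      atTop (𝓝 l)) :
    ∫ t in Ioi (0 : ℝ), (inner ℝ (v t) (b + ∫ s in (0 : ℝ)..t, w s)
        + inner ℝ (a + ∫ s in (0 : ℝ)..t, v s) (w t)) = l - inner ℝ a b := by
  refine tendsto_nhds_unique (intervalIntegral_tendsto_integral_Ioi 0 hint tendsto_id) ?_
  simp only [id, intervalIntegral_inner_primitive a b _ hv hw]
  exact hlim.sub_const _

/-- Integration by parts on the half-line for square integrable functions with square integrable
derivatives. -/
theorem integral_Ioi_inner_primitive_of_integrable {v w : ℝ → E} {a b : E}
    (hv : LocallyIntegrable v volume) (hw : LocallyIntegrable w volume)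
    (hint : IntegrableOn (fun t => inner ℝ (v t) (b + ∫ s in (0 : ℝ)..t, w s)
        + inner ℝ (a + ∫ s in (0 : ℝ)..t, v s) (w t)) (Ioi 0))
    (hint' : IntegrableOn (fun t => inner ℝ (a + ∫ s in (0 : ℝ)..t, v s)
      (b + ∫ s in (0 : ℝ)..t, w s)) (Ioi 0)) :
    ∫ t in Ioi (0 : ℝ), (inner ℝ (v t) (b + ∫ s in (0 : ℝ)..t, w s)
        + inner ℝ (a + ∫ s in (0 : ℝ)..t, v s) (w t)) = - inner ℝ a b := by
  have hlim := (intervalIntegral_tendsto_integral_Ioi 0 hint tendsto_id).add_const (inner ℝ a b)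
  simp only [id, intervalIntegral_inner_primitive a b _ hv hw, sub_add_cancel] at hlim
  rw [integral_Ioi_inner_primitive hv hw hint hlim]
  -- The inner product converges at infinity because its derivative is integrable; being itself
  -- integrable, it can only tend to `0`.
  have h0 := IntegrableAtFilter.eq_zero_of_tendsto (l := atTop) (μ := volume)
    ⟨Ioi 0, Ioi_mem_atTop 0, hint'⟩ (fun s hs => ?_) hlim
  · rw [h0, zero_sub]
  · obtain ⟨c, hc⟩ := mem_atTop_sets.1 hs
    rw [← top_le_iff, ← Real.volume_Ici (a := c)]
    exact measure_mono hc

/-- A primitive has the expected weak derivative. -/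
theorem integral_deriv_smul_primitive {v : ℝ → E} (a : E) (hv : LocallyIntegrable v volume)
    {φ : ℝ → ℝ} (hφ : ContDiff ℝ ∞ φ) (hc : HasCompactSupport φ) (hs : tsupport φ ⊆ Ioi 0) :
    ∫ t in Ioi (0 : ℝ), deriv φ t • (a + ∫ s in (0 : ℝ)..t, v s)
      = - ∫ t in Ioi (0 : ℝ), φ t • v t := by
  have hφ' : Continuous (deriv φ) := hφ.continuous_deriv (by simp)
  have h0 : φ 0 = 0 := image_eq_zero_of_notMem_tsupport fun h => lt_irrefl (0 : ℝ) (mem_Ioi.1 (hs h))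
  have hprim : ∀ t, ∫ s in (0 : ℝ)..t, deriv φ s = φ t := fun t => by
    rw [intervalIntegral.integral_deriv_eq_sub
      (fun x _ => (hφ.differentiable (by simp)).differentiableAt) (hφ'.intervalIntegrable _ _), h0,
      sub_zero]
  have hF : Continuous fun t => a + ∫ s in (0 : ℝ)..t, v s :=
    continuous_const.add (continuous_primitive hv)
  have hi1 : Integrable (fun t => deriv φ t • (a + ∫ s in (0 : ℝ)..t, v s)) volume :=
    (hφ'.smul hF).integrable_of_hasCompactSupport hc.deriv.smul_right
  have hi2 : Integrable (fun t => φ t • v t) volume :=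
    hv.integrable_smul_left_of_hasCompactSupport hφ.continuous hc
  refine ext_inner_left ℝ fun e => ?_
  have hl : LocallyIntegrable (fun t => deriv φ t • e) volume :=
    (hφ'.smul continuous_const).locallyIntegrable
  have hprim' : ∀ t, ∫ s in (0 : ℝ)..t, deriv φ s • e = φ t • e := fun t => by
    rw [intervalIntegral.integral_smul_const, hprim]
  -- Integration by parts against `φ' e`, whose primitive from `0` is `φ e` because `φ` vanishes at
  -- `0`; compact support removes the term at infinity.
  have key := integral_Ioi_inner_primitive (a := 0) (b := a) (l := 0) hl hv
  simp only [hprim', zero_add, inner_smul_left, inner_zero_left, sub_zero, conj_trivial] at key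
  have e1 : ∀ t, deriv φ t * inner ℝ e (a + ∫ s in (0 : ℝ)..t, v s)
      = inner ℝ e (deriv φ t • (a + ∫ s in (0 : ℝ)..t, v s)) := fun t => by
    rw [inner_smul_right]
  have e2 : ∀ t, φ t * inner ℝ e (v t) = inner ℝ e (φ t • v t) := fun t => by
    rw [inner_smul_right]
  have hi1' := (hi1.integrableOn (s := Ioi 0)).const_inner (𝕜 := ℝ) e
  have hi2' := (hi2.integrableOn (s := Ioi 0)).const_inner (𝕜 := ℝ) e
  simp only [e1, e2] at key
  have h := key (hi1'.add hi2') ?_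
  · rw [integral_add hi1' hi2', integral_inner hi1.integrableOn,
      integral_inner hi2.integrableOn] at h
    rw [inner_neg_right]
    linarith
  · refine tendsto_const_nhds.congr' ?_
    obtain ⟨c, hc'⟩ := hc.isCompact.bddAbove
    filter_upwards [eventually_gt_atTop c] with t ht
    rw [image_eq_zero_of_notMem_tsupport fun h => absurd (hc' h) (not_le.2 ht), zero_mul]

end IntegrationByParts

/-! ### The lemma of du Bois-Reymond -/

section DuBoisReymond

/-- The primitive from `0` vanishes to the left of the support of `φ`, and to its right because the
total integral is zero. -/
theorem exists_primitive_of_integral_eq_zero {φ : ℝ → ℝ} (hφ : ContDiff ℝ ∞ φ)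
    (hc : HasCompactSupport φ) (hs : tsupport φ ⊆ Ioi 0) (h0 : ∫ t, φ t = 0) :
    ∃ Φ : ℝ → ℝ, ContDiff ℝ ∞ Φ ∧ HasCompactSupport Φ ∧ tsupport Φ ⊆ Ioi 0 ∧ deriv Φ = φ := by
  rcases (tsupport φ).eq_empty_or_nonempty with he | hne
  · rw [tsupport_eq_empty_iff] at he
    subst he
    exact ⟨0, contDiff_const, HasCompactSupport.zero, by simp [tsupport_eq_empty_iff.2 rfl],
      by ext; simp⟩
  obtain ⟨α, hα, hα'⟩ := hc.isCompact.exists_isLeast hne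
  obtain ⟨β, hβ, hβ'⟩ := hc.isCompact.exists_isGreatest hne
  have hα0 : 0 < α := hs hα
  have hout : ∀ t, t ∉ Icc α β → φ t = 0 := fun t ht =>
    image_eq_zero_of_notMem_tsupport fun h => ht ⟨hα' h, hβ' h⟩
  have hd : ∀ t, HasDerivAt (fun t => ∫ s in (0 : ℝ)..t, φ s) (φ t) t := fun t =>
    hφ.continuous.integral_hasStrictDerivAt 0 t |>.hasDerivAt
  have hderiv : deriv (fun t => ∫ s in (0 : ℝ)..t, φ s) = φ := funext fun t => (hd t).deriv
  have hsupp : Function.support (fun t => ∫ s in (0 : ℝ)..t, φ s) ⊆ Icc α β := by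
    intro t ht
    by_contra hn
    refine ht ?_
    rw [mem_Icc, not_and_or, not_le, not_le] at hn
    simp only
    rcases hn with h | h
    · rw [intervalIntegral.integral_congr (g := fun _ => (0 : ℝ)), intervalIntegral.integral_zero]
      intro s hs
      refine hout s fun h' => ?_
      have h2 := hs.2
      have := h'.1
      rcases le_total 0 t with h3 | h3
      · rw [max_eq_right h3] at h2; linarith
      · rw [max_eq_left h3] at h2; linarith
    · rw [intervalIntegral.integral_eq_integral_of_support_subset, h0]
      intro s hs
      by_contra hn
      refine hs (hout s fun h' => hn ⟨?_, ?_⟩)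
      · linarith [h'.1]
      · linarith [h'.2]
  have hts : tsupport (fun t => ∫ s in (0 : ℝ)..t, φ s) ⊆ Icc α β :=
    closure_minimal hsupp isClosed_Icc
  refine ⟨_, contDiff_infty_iff_deriv.2 ⟨fun t => (hd t).differentiableAt, by
    rw [hderiv]; exact hφ⟩,
    isCompact_Icc.of_isClosed_subset (isClosed_tsupport _) hts, hts.trans fun t ht => ?_, hderiv⟩
  exact hα0.trans_le ht.1

variable {E : Type*} [NormedAddCommGroup E] [NormedSpace ℝ E] [CompleteSpace E]

theorem ae_eq_const_of_integral_deriv_smul_eq_zero {g : ℝ → E} (hg : LocallyIntegrable g halfLine)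
    (h : ∀ φ : ℝ → ℝ, ContDiff ℝ ∞ φ → HasCompactSupport φ → tsupport φ ⊆ Ioi 0 →
      ∫ t, deriv φ t • g t ∂halfLine = 0) :
    ∃ c : E, g =ᵐ[halfLine] fun _ => c := by
  -- A bump `η` of integral `1` supported in `[1/2, 3/2]`. For any test function `ψ`, the difference
  -- `ψ - (∫ ψ) η` has mean zero and so is the derivative of a test function; this identifies the
  -- constant as `∫ η g`.
  let f : ContDiffBump (1 : ℝ) := ⟨1 / 4, 1 / 2, by norm_num, by norm_num⟩
  let η := f.normed volume
  have hη : ContDiff ℝ ∞ η := f.contDiff_normed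
  have hηc : HasCompactSupport η := f.hasCompactSupport_normed
  have hηs : tsupport η ⊆ Ioi 0 := by
    rw [f.tsupport_normed_eq]
    intro t ht
    rw [Metric.mem_closedBall, Real.dist_eq, abs_le] at ht
    have : f.rOut = 1 / 2 := rfl
    have h2 := ht.1
    rw [this] at h2
    rw [mem_Ioi]
    linarith
  have hη1 : ∫ t, η t = 1 := f.integral_normed
  have hint : ∀ {φ : ℝ → ℝ}, ContDiff ℝ ∞ φ → HasCompactSupport φ →
      Integrable (fun t => φ t • g t) halfLine := fun hφ hc =>
    hg.integrable_smul_left_of_hasCompactSupport hφ.continuous hc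
  refine ⟨∫ t, η t • g t ∂halfLine, ?_⟩
  set c := ∫ t, η t • g t ∂halfLine with hcdef
  have hhalf : ∀ {ψ : ℝ → ℝ}, tsupport ψ ⊆ Ioi 0 → ∫ t, ψ t ∂halfLine = ∫ t, ψ t := fun hψ => by
    refine setIntegral_eq_integral_of_forall_compl_eq_zero fun t ht => ?_
    refine image_eq_zero_of_notMem_tsupport fun h' => ht ?_
    exact (mem_Ioi.1 (hψ h')).le
  have key : ∀ᵐ t ∂halfLine, t ∈ Ioi (0 : ℝ) → g t - c = 0 := by
    refine isOpen_Ioi.ae_eq_zero_of_integral_contDiff_smul_eq_zero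
      ((hg.sub (locallyIntegrable_const c)).locallyIntegrableOn _) ?_
    intro ψ hψ hψc hψs
    let m := ∫ t, ψ t
    have hφ : ContDiff ℝ ∞ (fun t => ψ t - m * η t) := hψ.sub (contDiff_const.mul hη)
    have hφc : HasCompactSupport (fun t => ψ t - m * η t) := hψc.sub hηc.mul_left
    have hφs : tsupport (fun t => ψ t - m * η t) ⊆ Ioi 0 :=
      (tsupport_sub _ _).trans (union_subset hψs ((tsupport_mul_subset_right).trans hηs))
    have hiψ : Integrable ψ volume := hψ.continuous.integrable_of_hasCompactSupport hψc
    have hiη : Integrable η volume := hη.continuous.integrable_of_hasCompactSupport hηc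
    have hφ0 : ∫ t, (ψ t - m * η t) = 0 := by
      rw [integral_sub hiψ (hiη.const_mul m), integral_const_mul, hη1, mul_one, sub_self]
    obtain ⟨Φ, h1, h2, h3, h4⟩ := exists_primitive_of_integral_eq_zero hφ hφc hφs hφ0
    have h5 := h Φ h1 h2 h3
    rw [h4] at h5
    simp only [sub_smul, mul_smul] at h5
    have h6 : Integrable (fun t => m • η t • g t) halfLine := (hint hη hηc).smul m
    rw [integral_sub (hint hψ hψc) h6, integral_smul, ← hcdef] at h5
    simp only [smul_sub]
    rw [integral_sub (hint hψ hψc) (hiψ.restrict.smul_const c), integral_smul_const, hhalf hψs]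
    exact h5
  have hpos : ∀ᵐ t ∂halfLine, t ∈ Ioi (0 : ℝ) := by
    rw [show halfLine = volume.restrict (Ioi (0 : ℝ)) from restrict_Ioi_eq_restrict_Ici.symm]
    exact ae_restrict_mem measurableSet_Ioi
  filter_upwards [key, hpos] with t h1 h2
  exact sub_eq_zero.1 (h1 h2)

end DuBoisReymond

/-! ### The Sobolev space on the half-line -/

section Sobolev

variable {𝕜 : Type*} [RCLike 𝕜] {d : ℕ}

theorem real_inner_eq_re_inner_euclidean (x y : EuclideanSpace 𝕜 (Fin d)) :
    inner ℝ x y = RCLike.re (inner 𝕜 x y) := by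
  rw [PiLp.inner_apply, PiLp.inner_apply, map_sum]
  exact Finset.sum_congr rfl fun i _ => by
    rw [real_inner_eq_re_inner 𝕜]

theorem locallyIntegrable_indicator (v : L2 𝕜 d) :
    LocallyIntegrable ((Ici (0 : ℝ)).indicator v) volume :=
  ((memLp_indicator_iff_restrict measurableSet_Ici).2 (Lp.memLp v)).locallyIntegrable (by norm_num)

theorem indicator_ae_eq (v : L2 𝕜 d) : (Ici (0 : ℝ)).indicator v =ᵐ[halfLine] v :=
  indicator_ae_eq_restrict measurableSet_Ici

theorem hasWeakDeriv_of_ae_eq_primitive {u v : L2 𝕜 d} {a : EuclideanSpace 𝕜 (Fin d)}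
    (h : u =ᵐ[halfLine] fun t => a + ∫ s in (0 : ℝ)..t, (Ici (0 : ℝ)).indicator v s) :
    HasWeakDeriv u v := by
  intro φ hφ hc hs
  have h1 := integral_deriv_smul_primitive a (locallyIntegrable_indicator v) hφ hc hs
  rw [← integral_Ici_eq_integral_Ioi, ← integral_Ici_eq_integral_Ioi] at h1
  rw [integral_congr_ae (g := fun t => deriv φ t •
    (a + ∫ s in (0 : ℝ)..t, (Ici (0 : ℝ)).indicator v s)), h1]
  · congr 1
    refine integral_congr_ae ?_
    filter_upwards [indicator_ae_eq v] with t ht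
    rw [ht]
  · filter_upwards [h] with t ht
    rw [ht]

theorem hasBoundaryValue_of_ae_eq_primitive {u v : L2 𝕜 d} {a : EuclideanSpace 𝕜 (Fin d)}
    (h : u =ᵐ[halfLine] fun t => a + ∫ s in (0 : ℝ)..t, (Ici (0 : ℝ)).indicator v s) :
    HasBoundaryValue u a :=
  ⟨_, (continuous_const.add (continuous_primitive (locallyIntegrable_indicator v))).continuousOn,
    h, by simp⟩

theorem HasBoundaryValue.unique {u : L2 𝕜 d} {a b : EuclideanSpace 𝕜 (Fin d)}
    (ha : HasBoundaryValue u a) (hb : HasBoundaryValue u b) : a = b := by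
  obtain ⟨f, hf, huf, rfl⟩ := ha
  obtain ⟨g, hg, hug, rfl⟩ := hb
  exact Measure.eqOn_of_ae_eq (huf.symm.trans hug) hf hg
    (by rw [interior_Ici, closure_Ioi]) self_mem_Ici

/-- The difference of `u` and the primitive of `v` has weak derivative zero, so it is constant by du
Bois-Reymond. The indicator extends `v` by zero, so that the primitive is defined on the whole line.
-/
theorem HasWeakDeriv.exists_ae_eq_primitive {u v : L2 𝕜 d} (h : HasWeakDeriv u v) :
    ∃ a : EuclideanSpace 𝕜 (Fin d),
      u =ᵐ[halfLine] fun t => a + ∫ s in (0 : ℝ)..t, (Ici (0 : ℝ)).indicator v s := by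
  set F : ℝ → EuclideanSpace 𝕜 (Fin d) := fun t => ∫ s in (0 : ℝ)..t, (Ici (0 : ℝ)).indicator v s
    with hF
  have hFc : Continuous F := continuous_primitive (locallyIntegrable_indicator v)
  obtain ⟨a, ha⟩ := ae_eq_const_of_integral_deriv_smul_eq_zero (g := fun t => u t - F t)
    (((Lp.memLp u).locallyIntegrable (by norm_num)).sub hFc.locallyIntegrable) (by
      intro φ hφ hc hs
      have hφ' : Continuous (deriv φ) := hφ.continuous_deriv (by simp)
      have h1 := integral_deriv_smul_primitive 0 (locallyIntegrable_indicator v) hφ hc hs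
      simp only [zero_add] at h1
      rw [← integral_Ici_eq_integral_Ioi, ← integral_Ici_eq_integral_Ioi] at h1
      have h2 : Integrable (fun t => deriv φ t • F t) halfLine :=
        ((hφ'.smul hFc).integrable_of_hasCompactSupport hc.deriv.smul_right).restrict
      simp only [smul_sub]
      rw [integral_sub (integrable_smul_L2 hφ' hc.deriv u) h2, h φ hφ hc hs, h1, sub_neg_eq_add,
        neg_add_eq_zero]
      refine integral_congr_ae ?_
      filter_upwards [indicator_ae_eq v] with t ht
      rw [ht])
  refine ⟨a, ?_⟩
  filter_upwards [ha] with t ht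
  exact sub_eq_iff_eq_add.1 ht

theorem HasWeakDeriv.exists_hasBoundaryValue {u v : L2 𝕜 d} (h : HasWeakDeriv u v) :
    ∃ a, HasBoundaryValue u a :=
  h.exists_ae_eq_primitive.imp fun _ => hasBoundaryValue_of_ae_eq_primitive

theorem HasWeakDeriv.re_inner_add {u v w z : L2 𝕜 d} {a b : EuclideanSpace 𝕜 (Fin d)}
    (hu : HasWeakDeriv u v) (hw : HasWeakDeriv w z) (ha : HasBoundaryValue u a)
    (hb : HasBoundaryValue w b) :
    RCLike.re (inner 𝕜 v w + inner 𝕜 u z) = - RCLike.re (inner 𝕜 a b) := by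
  obtain ⟨a', hua⟩ := hu.exists_ae_eq_primitive
  obtain ⟨b', hwb⟩ := hw.exists_ae_eq_primitive
  obtain rfl := ha.unique (hasBoundaryValue_of_ae_eq_primitive hua)
  obtain rfl := hb.unique (hasBoundaryValue_of_ae_eq_primitive hwb)
  have hint : ∀ f g : L2 𝕜 d, Integrable (fun t => RCLike.re (inner 𝕜 (f t) (g t))) halfLine :=
    fun f g => (L2.integrable_inner f g).re
  have e1 : (fun t => RCLike.re (inner 𝕜 (v t) (w t)) + RCLike.re (inner 𝕜 (u t) (z t)))
      =ᵐ[halfLine] fun t => inner ℝ ((Ici (0 : ℝ)).indicator v t)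
        (b + ∫ s in (0 : ℝ)..t, (Ici (0 : ℝ)).indicator z s)
        + inner ℝ (a + ∫ s in (0 : ℝ)..t, (Ici (0 : ℝ)).indicator v s)
          ((Ici (0 : ℝ)).indicator z t) := by
    filter_upwards [hua, hwb, indicator_ae_eq v, indicator_ae_eq z] with t h1 h2 h3 h4
    rw [h3, h4, ← h1, ← h2, real_inner_eq_re_inner_euclidean, real_inner_eq_re_inner_euclidean]
  have e2 : (fun t => RCLike.re (inner 𝕜 (u t) (w t)))
      =ᵐ[halfLine] fun t => inner ℝ (a + ∫ s in (0 : ℝ)..t, (Ici (0 : ℝ)).indicator v s)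
        (b + ∫ s in (0 : ℝ)..t, (Ici (0 : ℝ)).indicator z s) := by
    filter_upwards [hua, hwb] with t h1 h2
    rw [← h1, ← h2, real_inner_eq_re_inner_euclidean]
  have i1 := ((hint v w).add (hint u z)).congr e1
  have i2 := (hint u w).congr e2
  have key := integral_Ioi_inner_primitive_of_integrable (locallyIntegrable_indicator v)
    (locallyIntegrable_indicator z) (IntegrableOn.mono_set i1 Ioi_subset_Ici_self)
    (IntegrableOn.mono_set i2 Ioi_subset_Ici_self)
  rw [← integral_Ici_eq_integral_Ioi, ← integral_congr_ae e1,
    integral_add (hint v w) (hint u z), real_inner_eq_re_inner_euclidean] at key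
  rw [map_add, ← key, L2.inner_def, L2.inner_def]
  congr 1
  · exact (integral_re (L2.integrable_inner v w)).symm
  · exact (integral_re (L2.integrable_inner u z)).symm

theorem HasBoundaryValue.smul {u : L2 𝕜 d} {a : EuclideanSpace 𝕜 (Fin d)} (c : 𝕜)
    (h : HasBoundaryValue u a) : HasBoundaryValue (c • u) (c • a) := by
  obtain ⟨f, hf, huf, hfa⟩ := h
  exact ⟨c • f, hf.const_smul c, (Lp.coeFn_smul c u).trans (huf.const_smul c), by simp [hfa]⟩

theorem HasBoundaryValue.add {u w : L2 𝕜 d} {a b : EuclideanSpace 𝕜 (Fin d)}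
    (h : HasBoundaryValue u a) (h' : HasBoundaryValue w b) : HasBoundaryValue (u + w) (a + b) := by
  obtain ⟨f, hf, huf, hfa⟩ := h
  obtain ⟨g, hg, hwg, hgb⟩ := h'
  exact ⟨f + g, hf.add hg, (Lp.coeFn_add u w).trans (huf.add hwg), by simp [hfa, hgb]⟩

/-- Integration by parts in `W^{1,2}([0,∞); 𝕜^d)`. -/
theorem HasWeakDeriv.inner_add {u v w z : L2 𝕜 d} {a b : EuclideanSpace 𝕜 (Fin d)}
    (hu : HasWeakDeriv u v) (hw : HasWeakDeriv w z) (ha : HasBoundaryValue u a)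
    (hb : HasBoundaryValue w b) :
    inner 𝕜 v w + inner 𝕜 u z = - inner 𝕜 a b := by
  refine RCLike.ext ?_ ?_
  · rw [hu.re_inner_add hw ha hb, map_neg]
  -- The imaginary part of the identity is the real part of the same identity for `I • u`.
  · have h := (hu.smul RCLike.I).re_inner_add hw (ha.smul RCLike.I) hb
    simp only [inner_smul_left, RCLike.conj_I, neg_mul, map_add, map_neg, RCLike.I_mul_re] at h
    simp only [map_add, map_neg]
    linarith

theorem hasWeakDeriv_of_hasDerivAt {u v : L2 𝕜 d} {f f' : ℝ → EuclideanSpace 𝕜 (Fin d)}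
    (hd : ∀ t, HasDerivAt f (f' t) t) (hf' : Continuous f') (hu : u =ᵐ[halfLine] f)
    (hv : v =ᵐ[halfLine] f') : HasWeakDeriv u v := by
  refine hasWeakDeriv_of_ae_eq_primitive (a := f 0) ?_
  have h2 : ∀ᵐ t ∂volume, t ∈ Ici (0 : ℝ) → v t = f' t :=
    (ae_restrict_iff' measurableSet_Ici).1 hv
  filter_upwards [hu, ae_restrict_mem measurableSet_Ici] with t ht ht0
  have h3 : ∫ s in (0 : ℝ)..t, (Ici (0 : ℝ)).indicator v s = ∫ s in (0 : ℝ)..t, f' s := by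
    refine intervalIntegral.integral_congr_ae ?_
    filter_upwards [h2] with r hr hrt
    rw [uIoc_of_le ht0] at hrt
    have : r ∈ Ici (0 : ℝ) := hrt.1.le
    rw [indicator_of_mem this, hr this]
  rw [ht, h3, intervalIntegral.integral_eq_sub_of_hasDerivAt (fun r _ => hd r)
    (hf'.intervalIntegrable _ _), add_sub_cancel]

/-! ### Exponential functions -/

theorem memLp_exp_smul {s : ℝ} (hs : 0 < s) (y : EuclideanSpace 𝕜 (Fin d)) :
    MemLp (fun t : ℝ => Real.exp (-s * t) • y) 2 halfLine := by
  have h1 : MemLp (fun t : ℝ => Real.exp (-s * t)) 2 halfLine := by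
    rw [memLp_two_iff_integrable_sq (by fun_prop)]
    have h2 : IntegrableOn (fun t => Real.exp ((-(2 * s)) * t)) (Ioi 0) volume :=
      integrableOn_exp_mul_Ioi (by linarith) 0
    rw [← integrableOn_Ici_iff_integrableOn_Ioi] at h2
    refine h2.congr (Eventually.of_forall fun t => ?_)
    simp only
    rw [← Real.exp_nat_mul]
    congr 1
    push_cast
    ring
  refine h1.of_le_mul (c := ‖y‖) (by fun_prop) (Eventually.of_forall fun t => ?_)
  rw [norm_smul, mul_comm]

/-- The function `t ↦ exp(-s t) y`. -/
def expElem {s : ℝ} (hs : 0 < s) (y : EuclideanSpace 𝕜 (Fin d)) : L2 𝕜 d :=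
  (memLp_exp_smul hs y).toLp _

theorem coeFn_expElem {s : ℝ} (hs : 0 < s) (y : EuclideanSpace 𝕜 (Fin d)) :
    expElem hs y =ᵐ[halfLine] fun t => Real.exp (-s * t) • y :=
  MemLp.coeFn_toLp _

theorem hasBoundaryValue_expElem {s : ℝ} (hs : 0 < s) (y : EuclideanSpace 𝕜 (Fin d)) :
    HasBoundaryValue (expElem hs y) y :=
  ⟨_, by fun_prop, coeFn_expElem hs y, by simp⟩

theorem hasWeakDeriv_expElem {s : ℝ} (hs : 0 < s) (y : EuclideanSpace 𝕜 (Fin d)) :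
    HasWeakDeriv (expElem hs y) ((-(s : 𝕜)) • expElem hs y) := by
  refine hasWeakDeriv_of_hasDerivAt (f' := fun t : ℝ => (-s * Real.exp (-s * t)) • y)
    (fun t => ?_) (by fun_prop) (coeFn_expElem hs y) ?_
  · have := (((hasDerivAt_id t).const_mul (-s)).exp).smul_const y
    simpa [mul_comm] using! this
  · filter_upwards [Lp.coeFn_smul (-(s : 𝕜)) (expElem hs y), coeFn_expElem hs y] with t h2 h3
    rw [h2, Pi.smul_apply, h3, mul_smul, ← RCLike.ofReal_neg, RCLike.real_smul_eq_coe_smul (K := 𝕜)]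
    rw [RCLike.real_smul_eq_coe_smul (K := 𝕜) (-s)]

theorem constOp_expElem (P : Matrix (Fin d) (Fin d) 𝕜) {s : ℝ} (hs : 0 < s)
    (y : EuclideanSpace 𝕜 (Fin d)) :
    constOp P (expElem hs y) = expElem hs (Matrix.toEuclideanCLM (n := Fin d) (𝕜 := 𝕜) P y) := by
  refine Lp.ext ?_
  have h1 := ContinuousLinearMap.coeFn_compLpL (p := 2) (μ := halfLine)
    (Matrix.toEuclideanCLM (n := Fin d) (𝕜 := 𝕜) P) (expElem hs y)
  filter_upwards [h1, coeFn_expElem hs y,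
    coeFn_expElem hs (Matrix.toEuclideanCLM (n := Fin d) (𝕜 := 𝕜) P y)] with t h2 h3 h4
  rw [h4]
  refine h2.trans ?_
  rw [h3, RCLike.real_smul_eq_coe_smul (K := 𝕜), map_smul, ← RCLike.real_smul_eq_coe_smul]

/-- Integration by parts replaces the computation of the integral: both derivatives are multiples of
the functions themselves. -/
theorem inner_expElem {s r : ℝ} (hs : 0 < s) (hr : 0 < r) (y z : EuclideanSpace 𝕜 (Fin d)) :
    inner 𝕜 (expElem hs y) (expElem hr z) = ((s + r : ℝ) : 𝕜)⁻¹ * inner 𝕜 y z := by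
  have h := (hasWeakDeriv_expElem hs y).inner_add (hasWeakDeriv_expElem hr z)
    (hasBoundaryValue_expElem hs y) (hasBoundaryValue_expElem hr z)
  rw [inner_smul_left, inner_smul_right, map_neg, RCLike.conj_ofReal] at h
  have hne : ((s + r : ℝ) : 𝕜) ≠ 0 := RCLike.ofReal_ne_zero.2 (by positivity)
  rw [eq_inv_mul_iff_mul_eq₀ hne]
  push_cast
  linear_combination -h

end Sobolev

/-! ### The quadratic form of `P₁` -/

section QuadraticForm

variable {𝕜 : Type*} [RCLike 𝕜] {d n₁ n₂ k : ℕ}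

theorem blockDiag_eq_diagonal (hd : n₁ + n₂ = d) (lam : Fin n₁ → ℝ) (th : Fin n₂ → ℝ) :
    blockDiag hd (realDiag 𝕜 lam) (realDiag 𝕜 th)
      = Matrix.diagonal fun a => ((Sum.elim lam th ((blockEquiv hd).symm a) : ℝ) : 𝕜) := by
  rw [blockDiag, realDiag, realDiag, Matrix.fromBlocks_diagonal, Matrix.reindex_apply,
    Matrix.submatrix_diagonal_equiv]
  congr 1
  funext a
  rcases h : (blockEquiv hd).symm a with i | j <;> simp [h]

theorem star_dotProduct_diagonal_mulVec {n : Type*} [Fintype n] [DecidableEq n] (l : n → ℝ)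
    (z : n → 𝕜) :
    star z ⬝ᵥ (Matrix.diagonal (fun a => (l a : 𝕜)) *ᵥ z) = ((∑ a, l a * ‖z a‖ ^ 2 : ℝ) : 𝕜) := by
  rw [dotProduct, RCLike.ofReal_sum]
  refine Finset.sum_congr rfl fun a _ => ?_
  rw [Matrix.mulVec_diagonal, Pi.star_apply, RCLike.star_def, mul_left_comm, RCLike.conj_mul]
  push_cast
  rfl

theorem inv_eq_conjTranspose_of_mem_unitaryGroup {S : Matrix (Fin d) (Fin d) 𝕜}
    (hS : S ∈ Matrix.unitaryGroup (Fin d) 𝕜) : S⁻¹ = Sᴴ :=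
  Matrix.inv_eq_left_inv (Matrix.mem_unitaryGroup_iff'.1 hS)

theorem mulVec_inv_mulVec {S : Matrix (Fin d) (Fin d) 𝕜}
    (hS : S ∈ Matrix.unitaryGroup (Fin d) 𝕜) (z : Fin d → 𝕜) : S *ᵥ (S⁻¹ *ᵥ z) = z := by
  rw [inv_eq_conjTranspose_of_mem_unitaryGroup hS, Matrix.mulVec_mulVec,
    ← Matrix.star_eq_conjTranspose, Matrix.mem_unitaryGroup_iff.1 hS, Matrix.one_mulVec]

/-- Since `S` is unitary, the form is diagonal in the coordinates `S y`. In particular its values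
are real. -/
theorem star_dotProduct_mulVec_self {P₁ S : Matrix (Fin d) (Fin d) 𝕜} {hd : n₁ + n₂ = d}
    {lam : Fin n₁ → ℝ} {th : Fin n₂ → ℝ} (hS : S ∈ Matrix.unitaryGroup (Fin d) 𝕜)
    (hdiag : P₁ = S⁻¹ * blockDiag hd (realDiag 𝕜 lam) (realDiag 𝕜 th) * S) (y : Fin d → 𝕜) :
    star y ⬝ᵥ (P₁ *ᵥ y) = ((∑ i, lam i * ‖(S *ᵥ y) (blockEquiv hd (Sum.inl i))‖ ^ 2
      + ∑ j, th j * ‖(S *ᵥ y) (blockEquiv hd (Sum.inr j))‖ ^ 2 : ℝ) : 𝕜) := by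
  rw [hdiag, inv_eq_conjTranspose_of_mem_unitaryGroup hS, ← Matrix.mulVec_mulVec,
    ← Matrix.mulVec_mulVec, Matrix.dotProduct_mulVec, ← Matrix.star_mulVec,
    blockDiag_eq_diagonal, star_dotProduct_diagonal_mulVec, ← Equiv.sum_comp (blockEquiv hd),
    Fintype.sum_sum_type]
  simp

theorem star_dotProduct_realDiag_add_mulVec (lam : Fin n₁ → ℝ) (th : Fin n₂ → ℝ)
    (U : Matrix (Fin n₂) (Fin n₁) 𝕜) (x : Fin n₁ → 𝕜) :
    star x ⬝ᵥ ((realDiag 𝕜 lam + Uᴴ * realDiag 𝕜 th * U) *ᵥ x)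
      = ((∑ i, lam i * ‖x i‖ ^ 2 + ∑ j, th j * ‖(U *ᵥ x) j‖ ^ 2 : ℝ) : 𝕜) := by
  rw [Matrix.add_mulVec, dotProduct_add, ← Matrix.mulVec_mulVec, ← Matrix.mulVec_mulVec,
    Matrix.dotProduct_mulVec (star x) Uᴴ, ← Matrix.star_mulVec, realDiag, realDiag,
    star_dotProduct_diagonal_mulVec, star_dotProduct_diagonal_mulVec, RCLike.ofReal_add]

/-- A subspace on which a Hermitian form is nonnegative has at most the dimension of a maximal
positive subspace. -/
theorem finrank_le_of_nonneg {P₁ S : Matrix (Fin d) (Fin d) 𝕜} {hd : n₁ + n₂ = d}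
    {lam : Fin n₁ → ℝ} {th : Fin n₂ → ℝ} (hth : ∀ i, th i < 0)
    (hS : S ∈ Matrix.unitaryGroup (Fin d) 𝕜)
    (hdiag : P₁ = S⁻¹ * blockDiag hd (realDiag 𝕜 lam) (realDiag 𝕜 th) * S)
    {V : Submodule 𝕜 (Fin d → 𝕜)} (hV : ∀ y ∈ V, 0 ≤ star y ⬝ᵥ (P₁ *ᵥ y)) :
    Module.finrank 𝕜 V ≤ n₁ := by
  -- The projection to the positive coordinates of `S y`. On its kernel only the negative part of
  -- the form remains, so nonnegativity forces `y = 0`.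
  let π : V →ₗ[𝕜] (Fin n₁ → 𝕜) :=
    LinearMap.funLeft 𝕜 𝕜 (fun i => blockEquiv hd (Sum.inl i)) ∘ₗ S.mulVecLin ∘ₗ V.subtype
  have hπ : Function.Injective π := by
    rw [injective_iff_map_eq_zero]
    intro y hy
    have h1 : ∀ i, (S *ᵥ (y : Fin d → 𝕜)) (blockEquiv hd (Sum.inl i)) = 0 := fun i =>
      congrFun hy i
    have h2 := hV y y.2
    rw [star_dotProduct_mulVec_self hS hdiag, RCLike.ofReal_nonneg] at h2
    simp only [h1, norm_zero, ne_eq, OfNat.ofNat_ne_zero, not_false_eq_true, zero_pow, mul_zero,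
      Finset.sum_const_zero, zero_add] at h2
    have h3 : ∀ j ∈ Finset.univ, th j * ‖(S *ᵥ (y : Fin d → 𝕜)) (blockEquiv hd (Sum.inr j))‖ ^ 2
        ≤ 0 := fun j _ => mul_nonpos_of_nonpos_of_nonneg (hth j).le (sq_nonneg _)
    have h4 := (Finset.sum_eq_zero_iff_of_nonpos h3).1 (le_antisymm (Finset.sum_nonpos h3) h2)
    have h5 : S *ᵥ (y : Fin d → 𝕜) = 0 := by
      funext a
      obtain ⟨i | j, rfl⟩ := (blockEquiv hd).surjective a
      · exact h1 i
      · have := h4 j (Finset.mem_univ _)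
        rcases mul_eq_zero.1 this with h | h
        · exact absurd h (hth j).ne
        · exact norm_eq_zero.1 (pow_eq_zero_iff two_ne_zero |>.1 h)
    refine Subtype.ext ?_
    have h6 : (Sᴴ * S) *ᵥ (y : Fin d → 𝕜) = 0 := by
      rw [← Matrix.mulVec_mulVec, h5, Matrix.mulVec_zero]
    rwa [← Matrix.star_eq_conjTranspose, Matrix.mem_unitaryGroup_iff'.1 hS,
      Matrix.one_mulVec] at h6
  simpa using LinearMap.finrank_le_finrank_of_injective hπ

theorem finrank_ker_mulVecLin {W : Matrix (Fin k) (Fin d) 𝕜} (hW : W.rank = k) :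
    k + Module.finrank 𝕜 (LinearMap.ker W.mulVecLin) = d := by
  have h := W.mulVecLin.finrank_range_add_finrank_ker
  rw [← Matrix.rank, hW] at h
  simpa using h

/-- The orthogonal complement, with respect to an indefinite Hermitian form, of a maximal
nonnegative subspace is nonpositive. -/
theorem re_nonpos_of_forall_orthogonal {P₁ S : Matrix (Fin d) (Fin d) 𝕜} {hd : n₁ + n₂ = d}
    {lam : Fin n₁ → ℝ} {th : Fin n₂ → ℝ} (hP₁ : P₁.IsHermitian) (hth : ∀ i, th i < 0)
    (hS : S ∈ Matrix.unitaryGroup (Fin d) 𝕜)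
    (hdiag : P₁ = S⁻¹ * blockDiag hd (realDiag 𝕜 lam) (realDiag 𝕜 th) * S)
    {V : Submodule 𝕜 (Fin d → 𝕜)} (hV : ∀ y ∈ V, 0 ≤ star y ⬝ᵥ (P₁ *ᵥ y))
    (hdim : Module.finrank 𝕜 V = n₁) {w : Fin d → 𝕜} (hw : ∀ y ∈ V, star y ⬝ᵥ (P₁ *ᵥ w) = 0) :
    RCLike.re (star w ⬝ᵥ (P₁ *ᵥ w)) ≤ 0 := by
  by_contra! hpos
  have hw' : ∀ y ∈ V, star w ⬝ᵥ (P₁ *ᵥ y) = 0 := fun y hy => by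
    have h := congrArg star (hw y hy)
    rwa [Matrix.star_dotProduct, star_star, star_zero, Matrix.star_mulVec, hP₁.eq,
      ← Matrix.dotProduct_mulVec] at h
  have hww : 0 ≤ star w ⬝ᵥ (P₁ *ᵥ w) := by
    rw [star_dotProduct_mulVec_self hS hdiag] at hpos ⊢
    rw [RCLike.ofReal_re] at hpos
    exact RCLike.ofReal_nonneg.2 hpos.le
  -- If the form were positive at `w`, it would be nonnegative on `V + span w`; maximality of the
  -- dimension puts `w` in `V`, hence orthogonal to itself.
  have hVw : ∀ x ∈ V ⊔ Submodule.span 𝕜 {w}, 0 ≤ star x ⬝ᵥ (P₁ *ᵥ x) := by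
    intro x hx
    obtain ⟨y, hy, z, hz, rfl⟩ := Submodule.mem_sup.1 hx
    obtain ⟨c, rfl⟩ := Submodule.mem_span_singleton.1 hz
    rw [star_add, Matrix.mulVec_add, add_dotProduct, dotProduct_add, dotProduct_add, star_smul,
      Matrix.mulVec_smul, dotProduct_smul, smul_dotProduct, smul_dotProduct, dotProduct_smul,
      hw y hy, hw' y hy, smul_zero, smul_zero, add_zero, zero_add, smul_eq_mul, smul_eq_mul,
      ← mul_assoc]
    exact add_nonneg (hV y hy) (mul_nonneg (star_mul_self_nonneg c) hww)
  have h1 := finrank_le_of_nonneg hth hS hdiag hVw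
  have h2 : V = V ⊔ Submodule.span 𝕜 {w} :=
    Submodule.eq_of_le_of_finrank_le le_sup_left (hdim ▸ h1)
  have h3 : w ∈ V := h2 ▸ Submodule.mem_sup_right (Submodule.mem_span_singleton_self w)
  rw [hw w h3, map_zero] at hpos
  exact lt_irrefl _ hpos

theorem blockRow_mulVec (hd : n₁ + n₂ = d) (U : Matrix (Fin n₂) (Fin n₁) 𝕜) (z : Fin d → 𝕜) :
    blockRow hd U *ᵥ z = U *ᵥ (fun i => z (blockEquiv hd (Sum.inl i)))
      + fun j => z (blockEquiv hd (Sum.inr j)) := by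
  rw [blockRow, Matrix.reindex_apply, Matrix.submatrix_mulVec_equiv]
  have h : z ∘ (blockEquiv hd).symm.symm = Sum.elim (fun i => z (blockEquiv hd (Sum.inl i)))
      (fun j => z (blockEquiv hd (Sum.inr j))) := by
    funext a
    rcases a with i | j <;> rfl
  rw [h, Matrix.fromCols_mulVec_sumElim, Matrix.one_mulVec]
  rfl

/-- The nonnegativity of the form on the kernel of the boundary matrix, in terms of the
parametrization `B [U I] S`. -/
theorem forall_ker_nonneg_iff {P₁ S : Matrix (Fin d) (Fin d) 𝕜} {hd : n₁ + n₂ = d}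
    {lam : Fin n₁ → ℝ} {th : Fin n₂ → ℝ} (hth : ∀ i, th i < 0)
    (hS : S ∈ Matrix.unitaryGroup (Fin d) 𝕜)
    (hdiag : P₁ = S⁻¹ * blockDiag hd (realDiag 𝕜 lam) (realDiag 𝕜 th) * S)
    {W : Matrix (Fin k) (Fin d) 𝕜} (hk : k ≤ n₂) (hW : W.rank = k) :
    (∀ y : Fin d → 𝕜, W *ᵥ y = 0 → 0 ≤ star y ⬝ᵥ (P₁ *ᵥ y)) ↔
      ∃ hkn : k = n₂, ∃ (B : Matrix (Fin n₂) (Fin n₂) 𝕜) (U : Matrix (Fin n₂) (Fin n₁) 𝕜),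
          IsUnit B ∧ W.reindex (finCongr hkn) (Equiv.refl _) = B * blockRow hd U * S ∧
          (realDiag 𝕜 lam + Uᴴ * realDiag 𝕜 th * U :
            Matrix (Fin n₁) (Fin n₁) 𝕜).PosSemidef := by
  constructor
  · intro h
    have hdim := finrank_le_of_nonneg hth hS hdiag (V := LinearMap.ker W.mulVecLin) h
    have hkn : k = n₂ := by
      have := finrank_ker_mulVecLin hW
      omega
    subst hkn
    -- The matrix `W S⁻¹` with its columns split into the positive and the negative block; these
    -- become `B U` and `B`.
    let W' : Matrix (Fin k) (Fin n₁ ⊕ Fin k) 𝕜 := (W * S⁻¹).submatrix id (blockEquiv hd)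
    have hSS : S⁻¹ * S = 1 := by
      rw [inv_eq_conjTranspose_of_mem_unitaryGroup hS]
      exact Matrix.mem_unitaryGroup_iff'.1 hS
    let vec : (Fin n₁ → 𝕜) → (Fin k → 𝕜) → Fin d → 𝕜 := fun x z =>
      S⁻¹ *ᵥ (Sum.elim x z ∘ (blockEquiv hd).symm)
    have hvec : ∀ x z, W *ᵥ vec x z = W'.toCols₁ *ᵥ x + W'.toCols₂ *ᵥ z := fun x z => by
      rw [← Matrix.fromCols_mulVec_sumElim, Matrix.fromCols_toCols, Matrix.mulVec_mulVec]
      simp only [W']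
      rw [Matrix.submatrix_mulVec_equiv]
      rfl
    have hvq : ∀ x z, star (vec x z) ⬝ᵥ (P₁ *ᵥ vec x z)
        = ((∑ i, lam i * ‖x i‖ ^ 2 + ∑ j, th j * ‖z j‖ ^ 2 : ℝ) : 𝕜) := fun x z => by
      rw [star_dotProduct_mulVec_self hS hdiag]
      simp only [vec, mulVec_inv_mulVec hS]
      simp
    -- A vector `z` killed by the second block puts `(0, z)` in the kernel, where the form is
    -- negative unless `z = 0`.
    have hB : IsUnit W'.toCols₂ := by
      refine Matrix.mulVec_injective_iff_isUnit.1 ?_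
      refine (injective_iff_map_eq_zero W'.toCols₂.mulVecLin).2 fun z hz => ?_
      have h1 := h (vec 0 z) (by rw [hvec, Matrix.mulVec_zero, zero_add]; exact hz)
      rw [hvq, RCLike.ofReal_nonneg] at h1
      simp only [Pi.zero_apply, norm_zero, ne_eq, OfNat.ofNat_ne_zero, not_false_eq_true, zero_pow,
        mul_zero, Finset.sum_const_zero, zero_add] at h1
      have h3 : ∀ j ∈ Finset.univ, th j * ‖z j‖ ^ 2 ≤ 0 := fun j _ =>
        mul_nonpos_of_nonpos_of_nonneg (hth j).le (sq_nonneg _)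
      have h4 := (Finset.sum_eq_zero_iff_of_nonpos h3).1 (le_antisymm (Finset.sum_nonpos h3) h1)
      funext j
      rcases mul_eq_zero.1 (h4 j (Finset.mem_univ _)) with h | h
      · exact absurd h (hth j).ne
      · exact norm_eq_zero.1 (pow_eq_zero_iff two_ne_zero |>.1 h)
    have hBdet : IsUnit W'.toCols₂.det := (Matrix.isUnit_iff_isUnit_det _).1 hB
    have hBU : W'.toCols₂ * (W'.toCols₂⁻¹ * W'.toCols₁) = W'.toCols₁ :=
      Matrix.mul_nonsing_inv_cancel_left _ _ hBdet
    refine ⟨rfl, W'.toCols₂, W'.toCols₂⁻¹ * W'.toCols₁, hB, ?_, ?_⟩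
    · have h1 : W'.toCols₂ * blockRow hd (W'.toCols₂⁻¹ * W'.toCols₁) = W * S⁻¹ := by
        rw [blockRow, Matrix.reindex_apply]
        have : W'.toCols₂ * (Matrix.fromCols (W'.toCols₂⁻¹ * W'.toCols₁) 1).submatrix
            (Equiv.refl (Fin k)).symm (blockEquiv hd).symm
            = (W'.toCols₂ * Matrix.fromCols (W'.toCols₂⁻¹ * W'.toCols₁) 1).submatrix id
              (blockEquiv hd).symm := rfl
        rw [this, Matrix.mul_fromCols, hBU, mul_one, Matrix.fromCols_toCols]
        simp only [W']
        rw [Matrix.submatrix_submatrix]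
        simp
      rw [h1, Matrix.mul_assoc, hSS, Matrix.mul_one]
      rfl
    · refine Matrix.PosSemidef.of_dotProduct_mulVec_nonneg ?_ fun x => ?_
      · refine Matrix.IsHermitian.add ?_ ?_
        · exact Matrix.isHermitian_diagonal_of_self_adjoint _ (by ext i; simp)
        · refine Matrix.isHermitian_conjTranspose_mul_mul _ ?_
          exact Matrix.isHermitian_diagonal_of_self_adjoint _ (by ext i; simp)
      -- The vectors with coordinates `(x, -U x)` lie in the kernel of `W`.
      · have h1 := h (vec x (-((W'.toCols₂⁻¹ * W'.toCols₁) *ᵥ x))) (by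
          rw [hvec, Matrix.mulVec_neg, Matrix.mulVec_mulVec, hBU, add_neg_cancel])
        rw [hvq] at h1
        rw [star_dotProduct_realDiag_add_mulVec]
        simpa only [Pi.neg_apply, norm_neg] using h1
  · rintro ⟨rfl, B, U, hB, hWB, hpos⟩ y hy
    have h1 : B *ᵥ (blockRow hd U *ᵥ (S *ᵥ y)) = 0 := by
      rw [Matrix.mulVec_mulVec, Matrix.mulVec_mulVec, ← hWB]
      exact hy
    have h2 : blockRow hd U *ᵥ (S *ᵥ y) = 0 :=
      Matrix.mulVec_injective_iff_isUnit.2 hB (h1.trans (Matrix.mulVec_zero B).symm)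
    rw [blockRow_mulVec] at h2
    have h3 := hpos.dotProduct_mulVec_nonneg (fun i => (S *ᵥ y) (blockEquiv hd (Sum.inl i)))
    rw [star_dotProduct_realDiag_add_mulVec] at h3
    rw [star_dotProduct_mulVec_self hS hdiag]
    have h4 : ∀ j, ‖(U *ᵥ fun i => (S *ᵥ y) (blockEquiv hd (Sum.inl i))) j‖
        = ‖(S *ᵥ y) (blockEquiv hd (Sum.inr j))‖ := fun j => by
      rw [eq_neg_of_add_eq_zero_left h2, Pi.neg_apply, norm_neg]
    simpa only [h4] using h3

end QuadraticForm

variable {𝕜 : Type*} [RCLike 𝕜] {d k : ℕ}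

/-! ### Test functions as elements of `L²` -/

section TestFunctions

theorem memLp_smul_of_hasCompactSupport {φ : ℝ → ℝ} (hφ : Continuous φ) (hc : HasCompactSupport φ)
    (e : EuclideanSpace 𝕜 (Fin d)) : MemLp (fun t => φ t • e) 2 halfLine :=
  (hφ.smul continuous_const).memLp_of_hasCompactSupport hc.smul_right

/-- The function `t ↦ φ(t) e`. -/
def testElem {φ : ℝ → ℝ} (hφ : Continuous φ) (hc : HasCompactSupport φ)
    (e : EuclideanSpace 𝕜 (Fin d)) : L2 𝕜 d :=
  (memLp_smul_of_hasCompactSupport hφ hc e).toLp _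

theorem inner_testElem {φ : ℝ → ℝ} (hφ : Continuous φ) (hc : HasCompactSupport φ)
    (e : EuclideanSpace 𝕜 (Fin d)) (u : L2 𝕜 d) :
    inner 𝕜 (testElem hφ hc e) u = inner 𝕜 e (∫ t, φ t • u t ∂halfLine) := by
  rw [← integral_inner (integrable_smul_L2 hφ hc u), L2.inner_def]
  refine integral_congr_ae ?_
  filter_upwards [(memLp_smul_of_hasCompactSupport hφ hc e).coeFn_toLp] with t ht
  rw [testElem, ht, RCLike.real_smul_eq_coe_smul (K := 𝕜), RCLike.real_smul_eq_coe_smul (K := 𝕜),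
    inner_smul_left, inner_smul_right, RCLike.conj_ofReal]

/-- Weak differentiability becomes a family of `L²` inner product identities: these pass to limits,
and they have the form in which orthogonality to a range yields a derivative. -/
theorem hasWeakDeriv_iff_inner {u v : L2 𝕜 d} :
    HasWeakDeriv u v ↔ ∀ (φ : ℝ → ℝ) (hφ : ContDiff ℝ ∞ φ) (hc : HasCompactSupport φ),
      tsupport φ ⊆ Ioi 0 → ∀ e : EuclideanSpace 𝕜 (Fin d),
        inner 𝕜 (testElem (hφ.continuous_deriv (by simp)) hc.deriv e) u
          = - inner 𝕜 (testElem hφ.continuous hc e) v := by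
  refine forall_congr' fun φ => forall_congr' fun hφ => forall_congr' fun hc =>
    forall_congr' fun hs => ?_
  simp only [inner_testElem, ← inner_neg_right]
  exact ⟨fun h e => by rw [h], fun h => ext_inner_left 𝕜 h⟩

theorem hasWeakDeriv_testElem {φ : ℝ → ℝ} (hφ : ContDiff ℝ ∞ φ) (hc : HasCompactSupport φ)
    (e : EuclideanSpace 𝕜 (Fin d)) :
    HasWeakDeriv (testElem hφ.continuous hc e)
      (testElem (hφ.continuous_deriv (by simp)) hc.deriv e) :=
  hasWeakDeriv_of_hasDerivAt
    (fun t => ((hφ.differentiable (by simp)).differentiableAt.hasDerivAt.smul_const e))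
    ((hφ.continuous_deriv (by simp)).smul continuous_const)
    (MemLp.coeFn_toLp _) (MemLp.coeFn_toLp _)

theorem hasBoundaryValue_testElem {φ : ℝ → ℝ} (hφ : Continuous φ) (hc : HasCompactSupport φ)
    (hs : tsupport φ ⊆ Ioi 0) (e : EuclideanSpace 𝕜 (Fin d)) :
    HasBoundaryValue (testElem hφ hc e) 0 := by
  refine ⟨fun t => φ t • e, (hφ.smul continuous_const).continuousOn, MemLp.coeFn_toLp _, ?_⟩
  have h0 : φ 0 = 0 :=
    image_eq_zero_of_notMem_tsupport fun h => lt_irrefl (0 : ℝ) (mem_Ioi.1 (hs h))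
  simp only [h0, zero_smul]

theorem HasWeakDeriv.of_tendsto {u v : ℕ → L2 𝕜 d} {u' v' : L2 𝕜 d}
    (h : ∀ n, HasWeakDeriv (u n) (v n)) (hu : Tendsto u atTop (𝓝 u'))
    (hv : Tendsto v atTop (𝓝 v')) : HasWeakDeriv u' v' := by
  rw [hasWeakDeriv_iff_inner]
  intro φ hφ hc hs e
  refine tendsto_nhds_unique (tendsto_const_nhds.inner hu) ?_
  refine (tendsto_const_nhds.inner hv).neg.congr fun n => ?_
  exact (hasWeakDeriv_iff_inner.1 (h n) φ hφ hc hs e).symm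

/-- The trace at `0` is continuous on `W^{1,2}`. -/
theorem HasBoundaryValue.tendsto {u v : ℕ → L2 𝕜 d} {u' v' : L2 𝕜 d}
    {a : ℕ → EuclideanSpace 𝕜 (Fin d)} {a' : EuclideanSpace 𝕜 (Fin d)}
    (h : ∀ n, HasWeakDeriv (u n) (v n)) (ha : ∀ n, HasBoundaryValue (u n) (a n))
    (ha' : HasBoundaryValue u' a')
    (hu : Tendsto u atTop (𝓝 u')) (hv : Tendsto v atTop (𝓝 v')) (z : EuclideanSpace 𝕜 (Fin d)) :
    Tendsto (fun n => inner 𝕜 (a n) z) atTop (𝓝 (inner 𝕜 a' z)) := by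
  have h' := HasWeakDeriv.of_tendsto h hu hv
  have hz := hasWeakDeriv_expElem one_pos z
  have hz' := hasBoundaryValue_expElem one_pos z
  -- Integration by parts against `exp(-t) z` expresses the trace through `L²` inner products with
  -- `u` and `v`.
  have e1 : ∀ n, inner 𝕜 (a n) z = - (inner 𝕜 (v n) (expElem one_pos z)
      + inner 𝕜 (u n) ((-((1 : ℝ) : 𝕜)) • expElem one_pos z)) := fun n => by
    rw [(h n).inner_add hz (ha n) hz', neg_neg]
  have e2 : inner 𝕜 a' z = - (inner 𝕜 v' (expElem one_pos z)
      + inner 𝕜 u' ((-((1 : ℝ) : 𝕜)) • expElem one_pos z)) := by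
    rw [h'.inner_add hz ha' hz', neg_neg]
  simp only [e1, e2]
  exact ((hv.inner tendsto_const_nhds).add (hu.inner tendsto_const_nhds)).neg

end TestFunctions

/-! ### Constant matrices acting on `L²` -/

section ConstOp

theorem inner_toEuclideanCLM (P : Matrix (Fin d) (Fin d) 𝕜) (x y : EuclideanSpace 𝕜 (Fin d)) :
    inner 𝕜 x (Matrix.toEuclideanCLM (n := Fin d) (𝕜 := 𝕜) P y)
      = star x.ofLp ⬝ᵥ (P *ᵥ y.ofLp) := by
  rw [EuclideanSpace.inner_eq_star_dotProduct, dotProduct_comm]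
  rfl

theorem toEuclideanCLM_inner (P : Matrix (Fin d) (Fin d) 𝕜) (x y : EuclideanSpace 𝕜 (Fin d)) :
    inner 𝕜 (Matrix.toEuclideanCLM (n := Fin d) (𝕜 := 𝕜) P x) y
      = inner 𝕜 x (Matrix.toEuclideanCLM (n := Fin d) (𝕜 := 𝕜) Pᴴ y) := by
  rw [← Matrix.star_eq_conjTranspose, map_star, ContinuousLinearMap.star_eq_adjoint,
    ContinuousLinearMap.adjoint_inner_right]

theorem coeFn_constOp (P : Matrix (Fin d) (Fin d) 𝕜) (u : L2 𝕜 d) :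
    constOp P u =ᵐ[halfLine] fun t => Matrix.toEuclideanCLM (n := Fin d) (𝕜 := 𝕜) P (u t) :=
  ContinuousLinearMap.coeFn_compLpL (p := 2) (μ := halfLine) _ u

theorem continuous_constOp (P : Matrix (Fin d) (Fin d) 𝕜) : Continuous (constOp P) :=
  ((Matrix.toEuclideanCLM (n := Fin d) (𝕜 := 𝕜) P).compLpL 2 halfLine).continuous

theorem constOp_inner (P : Matrix (Fin d) (Fin d) 𝕜) (u w : L2 𝕜 d) :
    inner 𝕜 (constOp P u) w = inner 𝕜 u (constOp Pᴴ w) := by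
  rw [L2.inner_def, L2.inner_def]
  refine integral_congr_ae ?_
  filter_upwards [coeFn_constOp P u, coeFn_constOp Pᴴ w] with t h1 h2
  rw [h1, h2, toEuclideanCLM_inner]

theorem constOp_constOp (P Q : Matrix (Fin d) (Fin d) 𝕜) (u : L2 𝕜 d) :
    constOp P (constOp Q u) = constOp (P * Q) u := by
  refine Lp.ext ?_
  filter_upwards [coeFn_constOp P (constOp Q u), coeFn_constOp Q u, coeFn_constOp (P * Q) u]
    with t h1 h2 h3
  rw [h1, h2, h3, map_mul]
  rfl

theorem constOp_one (u : L2 𝕜 d) : constOp 1 u = u := by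
  refine Lp.ext ?_
  filter_upwards [coeFn_constOp 1 u] with t h1
  rw [h1, map_one]
  rfl

theorem constOp_inv_constOp {P : Matrix (Fin d) (Fin d) 𝕜} (hP : IsUnit P) (u : L2 𝕜 d) :
    constOp P⁻¹ (constOp P u) = u := by
  rw [constOp_constOp, Matrix.nonsing_inv_mul _ ((Matrix.isUnit_iff_isUnit_det _).1 hP),
    constOp_one]

theorem constOp_constOp_inv {P : Matrix (Fin d) (Fin d) 𝕜} (hP : IsUnit P) (u : L2 𝕜 d) :
    constOp P (constOp P⁻¹ u) = u := by
  rw [constOp_constOp, Matrix.mul_nonsing_inv _ ((Matrix.isUnit_iff_isUnit_det _).1 hP),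
    constOp_one]

theorem HasWeakDeriv.constOp {u v : L2 𝕜 d} (h : HasWeakDeriv u v)
    (P : Matrix (Fin d) (Fin d) 𝕜) : HasWeakDeriv (PortHam.constOp P u) (PortHam.constOp P v) := by
  have key : ∀ {φ : ℝ → ℝ}, Continuous φ → HasCompactSupport φ → ∀ u : L2 𝕜 d,
      ∫ t, φ t • PortHam.constOp P u t ∂halfLine
        = Matrix.toEuclideanCLM (n := Fin d) (𝕜 := 𝕜) P (∫ t, φ t • u t ∂halfLine) := by
    intro φ hφ hc u
    rw [← ContinuousLinearMap.integral_comp_comm _ (integrable_smul_L2 hφ hc u)]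
    refine integral_congr_ae ?_
    filter_upwards [coeFn_constOp P u] with t ht
    rw [ht, RCLike.real_smul_eq_coe_smul (K := 𝕜), RCLike.real_smul_eq_coe_smul (K := 𝕜), map_smul]
  intro φ hφ hc hs
  rw [key (hφ.continuous_deriv (by simp)) hc.deriv, key hφ.continuous hc, h φ hφ hc hs, map_neg]

theorem HasBoundaryValue.constOp {u : L2 𝕜 d} {a : EuclideanSpace 𝕜 (Fin d)}
    (h : HasBoundaryValue u a) (P : Matrix (Fin d) (Fin d) 𝕜) :
    HasBoundaryValue (PortHam.constOp P u) (Matrix.toEuclideanCLM (n := Fin d) (𝕜 := 𝕜) P a) := by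
  obtain ⟨f, hf, huf, rfl⟩ := h
  refine ⟨fun t => Matrix.toEuclideanCLM (n := Fin d) (𝕜 := 𝕜) P (f t),
    (ContinuousLinearMap.continuous _).comp_continuousOn hf, ?_, rfl⟩
  filter_upwards [coeFn_constOp P u, huf] with t h1 h2
  rw [h1, h2]

/-- The boundary form: `Re ⟨P₁ u', u⟩ = - u(0)* P₁ u(0) / 2`. -/
theorem HasWeakDeriv.re_inner_constOp {P : Matrix (Fin d) (Fin d) 𝕜} (hP : P.IsHermitian)
    {u v : L2 𝕜 d} {a : EuclideanSpace 𝕜 (Fin d)} (h : HasWeakDeriv u v)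
    (ha : HasBoundaryValue u a) :
    RCLike.re (inner 𝕜 (PortHam.constOp P v) u)
      = - (RCLike.re (star a.ofLp ⬝ᵥ (P *ᵥ a.ofLp)) / 2) := by
  have h1 := congrArg RCLike.re ((h.constOp P).inner_add h (ha.constOp P) ha)
  rw [constOp_inner P u, hP.eq, toEuclideanCLM_inner, hP.eq, inner_toEuclideanCLM, map_add,
    map_neg, inner_re_symm (𝕜 := 𝕜) u] at h1
  linarith

theorem star_dotProduct_matRe_mulVec (P : Matrix (Fin d) (Fin d) 𝕜) (x : Fin d → 𝕜) :
    star x ⬝ᵥ (matRe P *ᵥ x) = ((RCLike.re (star x ⬝ᵥ (P *ᵥ x)) : ℝ) : 𝕜) := by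
  have h : star x ⬝ᵥ (Pᴴ *ᵥ x) = star (star x ⬝ᵥ (P *ᵥ x)) := by
    rw [← Matrix.star_dotProduct, Matrix.star_mulVec, ← Matrix.dotProduct_mulVec]
  rw [matRe, Matrix.smul_mulVec, Matrix.add_mulVec, dotProduct_smul, dotProduct_add, h,
    RCLike.star_def, RCLike.add_conj, smul_eq_mul, inv_mul_cancel_left₀ two_ne_zero]

theorem negSemidef_matRe_iff {P : Matrix (Fin d) (Fin d) 𝕜} :
    NegSemidef (matRe P) ↔ ∀ x : Fin d → 𝕜, RCLike.re (star x ⬝ᵥ (P *ᵥ x)) ≤ 0 := by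
  refine forall_congr' fun x => ?_
  rw [star_dotProduct_matRe_mulVec, RCLike.ofReal_nonpos]

theorem re_inner_constOp_nonpos {P : Matrix (Fin d) (Fin d) 𝕜} (hP : NegSemidef (matRe P))
    (u : L2 𝕜 d) : RCLike.re (inner 𝕜 (constOp P u) u) ≤ 0 := by
  rw [inner_re_symm (𝕜 := 𝕜), L2.inner_def, ← integral_re (L2.integrable_inner u (constOp P u))]
  refine integral_nonpos_of_ae ?_
  filter_upwards [coeFn_constOp P u] with t ht
  rw [ht, inner_toEuclideanCLM]
  exact negSemidef_matRe_iff.1 hP _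

end ConstOp

/-! ### The operator `A` -/

section OpA

variable {P₀ P₁ : Matrix (Fin d) (Fin d) 𝕜} {W : Matrix (Fin k) (Fin d) 𝕜}

theorem opA_apply {u v : L2 𝕜 d} (hu : u ∈ domainA W) (hv : HasWeakDeriv u v) :
    opA P₀ P₁ W ⟨u, hu⟩ = constOp P₀ u + constOp P₁ v := by
  have h : weakDeriv 𝕜 d ⟨u, domainA_le_W12 W hu⟩ = v :=
    HasWeakDeriv.unique (Exists.choose_spec (domainA_le_W12 W hu)) hv
  exact congrArg (fun z => constOp P₀ u + constOp P₁ z) h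

theorem re_inner_opA (hP₁ : P₁.IsHermitian) {u v : L2 𝕜 d} {a : EuclideanSpace 𝕜 (Fin d)}
    (hu : u ∈ domainA W) (hv : HasWeakDeriv u v) (ha : HasBoundaryValue u a) :
    RCLike.re (inner 𝕜 (opA P₀ P₁ W ⟨u, hu⟩) u) = RCLike.re (inner 𝕜 (constOp P₀ u) u)
      - RCLike.re (star a.ofLp ⬝ᵥ (P₁ *ᵥ a.ofLp)) / 2 := by
  rw [opA_apply hu hv, inner_add_left, map_add, hv.re_inner_constOp hP₁ ha, sub_eq_add_neg]

theorem isDissipative_opA (hP₁ : P₁.IsHermitian) (hP₀ : NegSemidef (matRe P₀))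
    (hW : ∀ y : Fin d → 𝕜, W *ᵥ y = 0 → 0 ≤ star y ⬝ᵥ (P₁ *ᵥ y)) :
    IsDissipative (opA P₀ P₁ W) := by
  rintro ⟨u, ⟨v, hv⟩, a, ha, hWa⟩
  rw [re_inner_opA hP₁ ⟨⟨v, hv⟩, a, ha, hWa⟩ hv ha]
  have h1 := re_inner_constOp_nonpos hP₀ u
  have h2 := (RCLike.nonneg_iff.1 (hW _ hWa)).1
  linarith

theorem re_inner_constOp_expElem (P : Matrix (Fin d) (Fin d) 𝕜) {s r : ℝ} (hs : 0 < s) (hr : 0 < r)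
    (y : EuclideanSpace 𝕜 (Fin d)) :
    RCLike.re (inner 𝕜 (constOp P (expElem hs y)) (expElem hr y))
      = (s + r)⁻¹ * RCLike.re (star y.ofLp ⬝ᵥ (P *ᵥ y.ofLp)) := by
  rw [constOp_expElem, inner_expElem, ← RCLike.ofReal_inv, RCLike.re_ofReal_mul,
    inner_re_symm (𝕜 := 𝕜), inner_toEuclideanCLM]

/-- The function `(exp(-t) - exp(-2t)) y` vanishes at `0`, so it lies in the domain for every `W`
and has no boundary term. Its pairing with `P₀` is `1/2 - 2/3 + 1/4 = 1/12` times `Re (y* P₀ y)`. -/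
theorem negSemidef_of_isDissipative_opA (hP₁ : P₁.IsHermitian)
    (h : IsDissipative (opA P₀ P₁ W)) : NegSemidef (matRe P₀) := by
  rw [negSemidef_matRe_iff]
  intro x
  let y : EuclideanSpace 𝕜 (Fin d) := WithLp.toLp 2 x
  have hv := (hasWeakDeriv_expElem (𝕜 := 𝕜) one_pos y).add
    ((hasWeakDeriv_expElem two_pos y).smul (-1 : 𝕜))
  have ha := (hasBoundaryValue_expElem (𝕜 := 𝕜) one_pos y).add
    ((hasBoundaryValue_expElem two_pos y).smul (-1 : 𝕜))
  have e : y + (-1 : 𝕜) • y = 0 := by simp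
  rw [e] at ha
  have hu : expElem one_pos y + (-1 : 𝕜) • expElem two_pos y ∈ domainA W :=
    ⟨⟨_, hv⟩, 0, ha, by simp⟩
  have h1 := h ⟨_, hu⟩
  rw [re_inner_opA hP₁ hu hv ha] at h1
  simp only [map_add, inner_add_left, inner_add_right, neg_smul, one_smul, inner_neg_left,
    inner_neg_right, map_neg, re_inner_constOp_expElem] at h1
  have h2 : RCLike.re (star y.ofLp ⬝ᵥ (P₀ *ᵥ y.ofLp)) ≤ 0 := by
    simp at h1
    linarith
  exact h2

theorem forall_ker_nonneg_of_isDissipative_opA (hP₁ : P₁.IsHermitian)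
    (h : IsDissipative (opA P₀ P₁ W)) {x : Fin d → 𝕜} (hx : W *ᵥ x = 0) :
    0 ≤ RCLike.re (star x ⬝ᵥ (P₁ *ᵥ x)) := by
  let y : EuclideanSpace 𝕜 (Fin d) := WithLp.toLp 2 x
  have key : ∀ s : ℝ, 0 < s → RCLike.re (star x ⬝ᵥ (P₀ *ᵥ x))
      ≤ s * RCLike.re (star x ⬝ᵥ (P₁ *ᵥ x)) := by
    intro s hs
    have hv := hasWeakDeriv_expElem (𝕜 := 𝕜) hs y
    have ha := hasBoundaryValue_expElem (𝕜 := 𝕜) hs y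
    have hu : expElem hs y ∈ domainA W := ⟨⟨_, hv⟩, y, ha, hx⟩
    have h1 := h ⟨_, hu⟩
    rw [re_inner_opA hP₁ hu hv ha, re_inner_constOp_expElem, ← two_mul, mul_inv, mul_assoc,
      sub_nonpos, inv_mul_eq_div, div_le_div_iff_of_pos_right two_pos, inv_mul_le_iff₀ hs] at h1
    exact h1
  by_contra! hneg
  set q := RCLike.re (star x ⬝ᵥ (P₁ *ᵥ x))
  set r := RCLike.re (star x ⬝ᵥ (P₀ *ᵥ x))
  -- This `s` gives `s q = -(|r| + 1) < r`, contradicting `key`.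
  have h1 := key ((|r| + 1) / -q) (div_pos (by positivity) (by linarith))
  rw [div_neg, neg_mul, div_mul_cancel₀ _ hneg.ne] at h1
  linarith [neg_abs_le r]

end OpA


/-! ### The multiplication operator `𝓗` -/

section MulOp

theorem coeFn_mulOp {G : ℝ → Matrix (Fin d) (Fin d) 𝕜} (hG : EssBounded G) (u : L2 𝕜 d) :
    mulOp G hG u =ᵐ[halfLine]
      fun t => Matrix.toEuclideanCLM (n := Fin d) (𝕜 := 𝕜) (G t) (u t) :=
  (hG.memLp_mulVec u).coeFn_toLp

theorem isSymmetric_mulOp {G : ℝ → Matrix (Fin d) (Fin d) 𝕜} (hG : EssBounded G)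
    (h : ∀ᵐ t ∂halfLine, (G t).IsHermitian) : (mulOp G hG).IsSymmetric := by
  intro u w
  rw [L2.inner_def, L2.inner_def]
  refine integral_congr_ae ?_
  filter_upwards [coeFn_mulOp hG u, coeFn_mulOp hG w, h] with t h1 h2 h3
  rw [h1, h2, toEuclideanCLM_inner, h3.eq]

theorem re_inner_mulOp_nonneg {G : ℝ → Matrix (Fin d) (Fin d) 𝕜} (hG : EssBounded G)
    (h : ∀ᵐ t ∂halfLine, (G t).PosSemidef) (u : L2 𝕜 d) :
    0 ≤ RCLike.re (inner 𝕜 u (mulOp G hG u)) := by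
  rw [L2.inner_def, ← integral_re (L2.integrable_inner u (mulOp G hG u))]
  refine integral_nonneg_of_ae ?_
  filter_upwards [coeFn_mulOp hG u, h] with t h1 h2
  rw [h1, inner_toEuclideanCLM]
  exact (RCLike.nonneg_iff.1 (h2.dotProduct_mulVec_nonneg _)).1

theorem mulOp_mulOp_eq_self {G K : ℝ → Matrix (Fin d) (Fin d) 𝕜} (hG : EssBounded G)
    (hK : EssBounded K) (h : ∀ᵐ t ∂halfLine, K t * G t = 1) (u : L2 𝕜 d) :
    mulOp K hK (mulOp G hG u) = u := by
  refine Lp.ext ?_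
  filter_upwards [coeFn_mulOp hK (mulOp G hG u), coeFn_mulOp hG u, h] with t h1 h2 h3
  rw [h1, h2]
  refine Eq.trans ?_ (congrArg (fun T : EuclideanSpace 𝕜 (Fin d) →L[𝕜] EuclideanSpace 𝕜 (Fin d) =>
    T (u t)) ((congrArg (Matrix.toEuclideanCLM (n := Fin d) (𝕜 := 𝕜)) h3).trans (map_one _)))
  rw [map_mul]
  rfl

theorem isPositiveIso_mulOp {H : ℝ → Matrix (Fin d) (Fin d) 𝕜} (hH : EssBounded H)
    (hH_inv : EssBounded fun ζ => (H ζ)⁻¹) (hH_pos : ∀ᵐ ζ ∂halfLine, (H ζ).PosDef) :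
    IsPositiveIso (mulOp H hH) (mulOp _ hH_inv) where
  isSymmetric := isSymmetric_mulOp hH (hH_pos.mono fun _ h => h.1)
  nonneg := re_inner_mulOp_nonneg hH (hH_pos.mono fun _ h => h.posSemidef)
  isSymmetric_inv := isSymmetric_mulOp hH_inv (hH_pos.mono fun _ h => h.1.inv)
  left_inv := mulOp_mulOp_eq_self hH hH_inv (hH_pos.mono fun _ h =>
    Matrix.nonsing_inv_mul _ ((Matrix.isUnit_iff_isUnit_det _).1 h.isUnit))
  right_inv := mulOp_mulOp_eq_self hH_inv hH (hH_pos.mono fun _ h =>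
    Matrix.mul_nonsing_inv _ ((Matrix.isUnit_iff_isUnit_det _).1 h.isUnit))

theorem IsPositiveIso.symm {E : Type*} [NormedAddCommGroup E] [InnerProductSpace 𝕜 E]
    {G K : E →ₗ[𝕜] E} (h : IsPositiveIso G K) : IsPositiveIso K G where
  isSymmetric := h.isSymmetric_inv
  nonneg x := by
    have := h.nonneg (K x)
    rwa [h.right_inv, inner_re_symm] at this
  isSymmetric_inv := h.isSymmetric
  left_inv := h.right_inv
  right_inv := h.left_inv

end MulOp

/-! ### The range condition -/

section Range

variable {P₀ P₁ : Matrix (Fin d) (Fin d) 𝕜} {W : Matrix (Fin k) (Fin d) 𝕜}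

/-- The operator `A` is closed. -/
theorem mem_domainA_of_tendsto (hP₁_inv : IsUnit P₁) {u : ℕ → L2 𝕜 d} {u' f : L2 𝕜 d}
    (hu : ∀ n, u n ∈ domainA W) (hlim : Tendsto u atTop (𝓝 u'))
    (hA : Tendsto (fun n => opA P₀ P₁ W ⟨u n, hu n⟩) atTop (𝓝 f)) :
    ∃ h : u' ∈ domainA W, opA P₀ P₁ W ⟨u', h⟩ = f := by
  choose v hv using fun n => (hu n).1
  choose a ha hWa using fun n => (hu n).2
  -- As `P₁` is invertible, the derivative is recovered from `u` and `A u`; convergence of these two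
  -- therefore gives convergence in `W^{1,2}`.
  have h1 : ∀ n, constOp P₁⁻¹ (opA P₀ P₁ W ⟨u n, hu n⟩ - constOp P₀ (u n)) = v n := fun n => by
    rw [opA_apply (hu n) (hv n), add_sub_cancel_left, constOp_inv_constOp hP₁_inv]
  have hvlim : Tendsto v atTop (𝓝 (constOp P₁⁻¹ (f - constOp P₀ u'))) :=
    (((continuous_constOp P₁⁻¹).tendsto _).comp
      (hA.sub (((continuous_constOp P₀).tendsto u').comp hlim))).congr h1
  have hv' := HasWeakDeriv.of_tendsto hv hlim hvlim
  obtain ⟨a', ha'⟩ := hv'.exists_hasBoundaryValue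
  have hmem : u' ∈ domainA W := by
    refine ⟨⟨_, hv'⟩, a', ha', funext fun i => ?_⟩
    have hrow : ∀ b : EuclideanSpace 𝕜 (Fin d),
        (W *ᵥ b.ofLp) i = star (inner 𝕜 b (WithLp.toLp 2 (star (W i)))) := fun b => by
      rw [EuclideanSpace.inner_eq_star_dotProduct, ← Matrix.star_dotProduct_star, star_star,
        star_star]
      exact dotProduct_comm _ _
    have ht := HasBoundaryValue.tendsto hv ha ha' hlim hvlim (WithLp.toLp 2 (star (W i)))
    have h0 : ∀ n, inner 𝕜 (a n) (WithLp.toLp 2 (star (W i))) = (0 : 𝕜) := fun n => by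
      rw [← star_eq_zero, ← hrow, hWa]
      rfl
    simp only [h0] at ht
    rw [hrow, ← tendsto_nhds_unique tendsto_const_nhds ht, star_zero]
    rfl
  refine ⟨hmem, ?_⟩
  rw [opA_apply hmem hv', constOp_constOp_inv hP₁_inv, add_sub_cancel]

/-- An element orthogonal to the range of `l K - A` vanishes. -/
theorem eq_zero_of_forall_inner_eq_zero {n₁ n₂ : ℕ} {S : Matrix (Fin d) (Fin d) 𝕜}
    {hd : n₁ + n₂ = d} {lam : Fin n₁ → ℝ} {th : Fin n₂ → ℝ} (hP₁ : P₁.IsHermitian)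
    (hP₁_inv : IsUnit P₁) (hth : ∀ i, th i < 0) (hS : S ∈ Matrix.unitaryGroup (Fin d) 𝕜)
    (hdiag : P₁ = S⁻¹ * blockDiag hd (realDiag 𝕜 lam) (realDiag 𝕜 th) * S)
    (hP₀ : NegSemidef (matRe P₀))
    (hW : ∀ y : Fin d → 𝕜, W *ᵥ y = 0 → 0 ≤ star y ⬝ᵥ (P₁ *ᵥ y))
    (hdim : Module.finrank 𝕜 (LinearMap.ker W.mulVecLin) = n₁)
    {G K : L2 𝕜 d →ₗ[𝕜] L2 𝕜 d} (hGK : IsPositiveIso G K) {l : ℝ} (hl : 0 < l) {w : L2 𝕜 d}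
    (hw : ∀ u : (opA P₀ P₁ W).domain, inner 𝕜 ((l : 𝕜) • K u - opA P₀ P₁ W u) w = 0) : w = 0 := by
  set g := constOp P₀ᴴ w - (l : 𝕜) • K w with hg
  have key : ∀ {u v : L2 𝕜 d}, u ∈ domainA W → HasWeakDeriv u v →
      inner 𝕜 v (constOp P₁ w) = - inner 𝕜 u g := by
    intro u v hu hv
    have h := hw ⟨u, hu⟩
    rw [opA_apply hu hv, inner_sub_left, inner_add_left, constOp_inner, constOp_inner, hP₁.eq,
      inner_smul_left, RCLike.conj_ofReal, hGK.isSymmetric_inv] at h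
    rw [hg, inner_sub_right, inner_smul_right]
    linear_combination -h
  -- Test functions lie in the domain whatever `W` is, so orthogonality to the range contains the
  -- adjoint equation `(P₁ w)' = P₀* w - l K w`.
  have hgw : HasWeakDeriv (constOp P₁ w) g := by
    rw [hasWeakDeriv_iff_inner]
    intro φ hφ hc hs e
    have hv := hasWeakDeriv_testElem hφ hc e
    exact key ⟨⟨_, hv⟩, 0, hasBoundaryValue_testElem hφ.continuous hc hs e, by simp⟩ hv
  have hww : HasWeakDeriv w (constOp P₁⁻¹ g) := by
    have := hgw.constOp P₁⁻¹
    rwa [constOp_inv_constOp hP₁_inv] at this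
  obtain ⟨c, hc⟩ := hww.exists_hasBoundaryValue
  -- For `u = exp(-t) y` with `y ∈ ker W` the same relation holds, so the boundary term in the
  -- integration by parts must vanish.
  have horth : ∀ y ∈ LinearMap.ker W.mulVecLin, star y ⬝ᵥ (P₁ *ᵥ c.ofLp) = 0 := by
    intro y hy
    have hv := hasWeakDeriv_expElem (𝕜 := 𝕜) one_pos (WithLp.toLp 2 y)
    have ha := hasBoundaryValue_expElem (𝕜 := 𝕜) one_pos (WithLp.toLp 2 y)
    have h1 := hv.inner_add hgw ha (hc.constOp P₁)
    rw [key ⟨⟨_, hv⟩, _, ha, hy⟩ hv, neg_add_cancel, inner_toEuclideanCLM] at h1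
    exact neg_eq_zero.1 h1.symm
  have hq := re_nonpos_of_forall_orthogonal hP₁ hth hS hdiag (V := LinearMap.ker W.mulVecLin)
    hW hdim horth
  -- The energy balance of the adjoint equation: `Re ⟨P₀ w, w⟩ - l Re ⟨K w, w⟩ = - w(0)* P₁ w(0) /
  -- 2`, whose right side is nonnegative by `hq`.
  have h1 := hww.re_inner_constOp hP₁ hc
  rw [constOp_constOp_inv hP₁_inv, hg, inner_sub_left, inner_smul_left, RCLike.conj_ofReal,
    map_sub, RCLike.re_ofReal_mul, inner_re_symm (𝕜 := 𝕜) (constOp P₀ᴴ w), ← constOp_inner,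
    inner_re_symm (𝕜 := 𝕜) (K w)] at h1
  have h2 := re_inner_constOp_nonpos hP₀ w
  have h3 : RCLike.re (inner 𝕜 w (K w)) ≤ 0 := by
    have h4 : l * RCLike.re (inner 𝕜 w (K w)) ≤ 0 := by linarith
    by_contra! h5
    linarith [mul_pos hl h5]
  obtain ⟨C, hC0, hC⟩ := hGK.symm.exists_coercive
  have h5 : ‖w‖ ^ 2 ≤ 0 := (hC w).trans (mul_nonpos_of_nonneg_of_nonpos hC0 h3)
  exact norm_eq_zero.1 (pow_eq_zero_iff two_ne_zero |>.1 (le_antisymm h5 (sq_nonneg _)))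

theorem exists_smul_sub_opA_eq (hP₁_inv : IsUnit P₁) (hA : IsDissipative (opA P₀ P₁ W))
    {G K : L2 𝕜 d →ₗ[𝕜] L2 𝕜 d} (hGK : IsPositiveIso G K) {l : ℝ} (hl : 0 < l)
    (horth : ∀ w : L2 𝕜 d,
      (∀ u : (opA P₀ P₁ W).domain, inner 𝕜 ((l : 𝕜) • K u - opA P₀ P₁ W u) w = 0) → w = 0) (y : L2 𝕜 d) :
    ∃ u : (opA P₀ P₁ W).domain, (l : 𝕜) • K u - opA P₀ P₁ W u = y := by
  let F : (opA P₀ P₁ W).domain →ₗ[𝕜] L2 𝕜 d :=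
    (l : 𝕜) • K ∘ₗ (opA P₀ P₁ W).domain.subtype - (opA P₀ P₁ W).toFun
  have hF : ∀ u, F u = (l : 𝕜) • K u - opA P₀ P₁ W u := fun u => rfl
  obtain ⟨C, hC0, hC⟩ := hGK.symm.exists_coercive
  -- Dissipativity of `A` and coercivity of `K` bound `F` from below; with the closedness of `A`
  -- this makes the range closed.
  have hbelow : ∀ u : (opA P₀ P₁ W).domain, l * ‖(u : L2 𝕜 d)‖ ≤ C * ‖F u‖ := by
    intro u
    have h1 : l * RCLike.re (inner 𝕜 (u : L2 𝕜 d) (K u))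
        ≤ RCLike.re (inner 𝕜 (F u) (u : L2 𝕜 d)) := by
      rw [hF, inner_sub_left, inner_smul_left, RCLike.conj_ofReal, map_sub, RCLike.re_ofReal_mul,
        inner_re_symm (𝕜 := 𝕜) (K u)]
      linarith [hA u]
    have h2 := (RCLike.re_le_norm _).trans (norm_inner_le_norm (𝕜 := 𝕜) (F u) (u : L2 𝕜 d))
    have h3 : l * ‖(u : L2 𝕜 d)‖ * ‖(u : L2 𝕜 d)‖ ≤ C * ‖F u‖ * ‖(u : L2 𝕜 d)‖ :=
      calc l * ‖(u : L2 𝕜 d)‖ * ‖(u : L2 𝕜 d)‖ = l * ‖(u : L2 𝕜 d)‖ ^ 2 := by ring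
        _ ≤ l * (C * RCLike.re (inner 𝕜 (u : L2 𝕜 d) (K u))) := by gcongr; exact hC _
        _ = C * (l * RCLike.re (inner 𝕜 (u : L2 𝕜 d) (K u))) := by ring
        _ ≤ C * (‖F u‖ * ‖(u : L2 𝕜 d)‖) := mul_le_mul_of_nonneg_left (h1.trans h2) hC0
        _ = _ := by ring
    rcases (norm_nonneg (u : L2 𝕜 d)).eq_or_lt with h | h
    · rw [← h, mul_zero]; positivity
    · exact le_of_mul_le_mul_right h3 h
  have hclosed : IsClosed (LinearMap.range F : Set (L2 𝕜 d)) := by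
    refine IsSeqClosed.isClosed fun f f' hf hlim => ?_
    choose u hu using hf
    have hc : CauchySeq fun n => (u n : L2 𝕜 d) := by
      refine Metric.cauchySeq_iff'.2 fun ε hε => ?_
      obtain ⟨N, hN⟩ := Metric.cauchySeq_iff'.1 hlim.cauchySeq (l * ε / (C + 1)) (by positivity)
      refine ⟨N, fun n hn => ?_⟩
      have h1 := hbelow (u n - u N)
      have h2 := hN n hn
      rw [dist_eq_norm, ← hu, ← hu, ← map_sub] at h2
      rw [dist_eq_norm]
      refine lt_of_mul_lt_mul_left ?_ hl.le
      calc l * ‖(u n : L2 𝕜 d) - u N‖ ≤ C * ‖F (u n - u N)‖ := h1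
        _ ≤ C * (l * ε / (C + 1)) := by gcongr
        _ < (C + 1) * (l * ε / (C + 1)) := by gcongr; linarith
        _ = l * ε := by field_simp
    obtain ⟨u', hu'⟩ := cauchySeq_tendsto_of_complete hc
    have hK := ((hGK.isSymmetric_inv.continuous.tendsto u').comp hu').const_smul (l : 𝕜)
    have hA' : Tendsto (fun n => opA P₀ P₁ W ⟨u n, (u n).2⟩) atTop (𝓝 ((l : 𝕜) • K u' - f')) := by
      refine (hK.sub hlim).congr fun n => ?_
      rw [← hu, hF]
      exact sub_sub_cancel _ _
    obtain ⟨h1, h2⟩ := mem_domainA_of_tendsto hP₁_inv (fun n => (u n).2) hu' hA'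
    refine ⟨⟨u', h1⟩, ?_⟩
    rw [hF, h2, sub_sub_cancel]
  have htop : LinearMap.range F = ⊤ := by
    have : CompleteSpace (LinearMap.range F) := hclosed.completeSpace_coe
    rw [← Submodule.orthogonal_eq_bot_iff, Submodule.eq_bot_iff]
    intro w hw
    exact horth w fun u => (Submodule.mem_orthogonal _ _).1 hw _ ⟨u, rfl⟩
  exact LinearMap.range_eq_top.1 htop y

end Range

/-! ### The operator `A𝓗` -/

section OpAH

variable {P₀ P₁ : Matrix (Fin d) (Fin d) 𝕜} {W : Matrix (Fin k) (Fin d) 𝕜}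
  {H : ℝ → Matrix (Fin d) (Fin d) 𝕜} {hH : EssBounded H}

theorem opAH_apply {x u : L2 𝕜 d} (hx : mulOp H hH x = u)
    (hxd : x ∈ (opAH P₀ P₁ W H hH).domain) (hu : u ∈ (opA P₀ P₁ W).domain) :
    opAH P₀ P₁ W H hH ⟨x, hxd⟩ = opA P₀ P₁ W ⟨u, hu⟩ := by
  subst hx
  rfl

theorem mem_domain_opAH {x u : L2 𝕜 d} (hx : mulOp H hH x = u) (hu : u ∈ (opA P₀ P₁ W).domain) :
    x ∈ (opAH P₀ P₁ W H hH).domain := by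
  subst hx
  exact hu

/-- The substitution `x = K u`, with `K` inverse to `𝓗`, carries dissipativity and the range
condition for `A𝓗` to those for `A`. -/
theorem generatesContractionSemigroup_opAH_iff {K : L2 𝕜 d →ₗ[𝕜] L2 𝕜 d}
    (hK : IsPositiveIso (mulOp H hH) K)
    (hr : IsDissipative (opA P₀ P₁ W) → ∀ l : ℝ, 0 < l → ∀ y : L2 𝕜 d,
      ∃ u : (opA P₀ P₁ W).domain, (l : 𝕜) • K u - opA P₀ P₁ W u = y) :
    GeneratesContractionSemigroup (energyNorm H hH) (opAH P₀ P₁ W H hH)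
      ↔ IsDissipative (opA P₀ P₁ W) := by
  have hnorm : energyNorm H hH
      = fun x : L2 𝕜 d => √(RCLike.re (inner 𝕜 x (mulOp H hH x))) := rfl
  rw [hnorm]
  constructor
  · rintro h ⟨u, hu⟩
    have h1 := hK.re_inner_nonpos_of_generates _ h ⟨K u, mem_domain_opAH (hK.right_inv u) hu⟩
    rwa [opAH_apply (hK.right_inv u) _ hu, hK.right_inv] at h1
  · intro h
    refine hK.generatesContractionSemigroup _ ?_ fun l hl y => ?_
    · rintro ⟨x, hx⟩
      have hx' : mulOp H hH x ∈ (opA P₀ P₁ W).domain := hx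
      rw [opAH_apply rfl hx hx']
      exact h ⟨_, hx'⟩
    · obtain ⟨⟨u, hu⟩, e⟩ := hr h l hl y
      refine ⟨⟨K u, mem_domain_opAH (hK.right_inv u) hu⟩, ?_⟩
      rw [opAH_apply (hK.right_inv u) _ hu]
      exact e

end OpAH

end

end PortHam

open PortHam in
theorem theorem2p5 {𝕜 : Type*} [RCLike 𝕜] {d k n₁ n₂ : ℕ}
    (P₀ P₁ : Matrix (Fin d) (Fin d) 𝕜) (hP₁ : P₁.IsHermitian) (hP₁_inv : IsUnit P₁)
    (hn₁ : n₁ = numPosEigenvalues hP₁) (hn₂ : n₂ = numNegEigenvalues hP₁) (hd : n₁ + n₂ = d)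
    (S : Matrix (Fin d) (Fin d) 𝕜) (hS : S ∈ Matrix.unitaryGroup (Fin d) 𝕜)
    (lam : Fin n₁ → ℝ) (hlam : ∀ i, 0 < lam i) (th : Fin n₂ → ℝ) (hth : ∀ i, th i < 0)
    (hdiag : P₁ = S⁻¹ * blockDiag hd (realDiag 𝕜 lam) (realDiag 𝕜 th) * S)
    (H : ℝ → Matrix (Fin d) (Fin d) 𝕜) (hH : EssBounded H) (hH_inv : EssBounded fun ζ => (H ζ)⁻¹)
    (hH_pos : ∀ᵐ ζ ∂halfLine, (H ζ).PosDef)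
    (WB : Matrix (Fin k) (Fin d) 𝕜) (hk : k ≤ n₂) (hWB : WB.rank = k) :
    List.TFAE [
      GeneratesContractionSemigroup (energyNorm H hH) (opAH P₀ P₁ WB H hH),
      IsDissipative (opA P₀ P₁ WB),
      NegSemidef (matRe P₀) ∧ ∀ y : Fin d → 𝕜, WB *ᵥ y = 0 → 0 ≤ star y ⬝ᵥ (P₁ *ᵥ y),
      NegSemidef (matRe P₀) ∧ ∃ hkn : k = n₂,
        ∃ (B : Matrix (Fin n₂) (Fin n₂) 𝕜) (U : Matrix (Fin n₂) (Fin n₁) 𝕜),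
          IsUnit B ∧
          WB.reindex (finCongr hkn) (Equiv.refl _) = B * blockRow hd U * S ∧
          (realDiag 𝕜 lam + Uᴴ * realDiag 𝕜 th * U :
            Matrix (Fin n₁) (Fin n₁) 𝕜).PosSemidef] := by
  have hiso := isPositiveIso_mulOp hH hH_inv hH_pos
  have hker := forall_ker_nonneg_iff hth hS hdiag hk hWB
  tfae_have 2 → 3 := fun h => by
    refine ⟨negSemidef_of_isDissipative_opA hP₁ h, fun y hy => ?_⟩
    have h1 := forall_ker_nonneg_of_isDissipative_opA hP₁ h hy
    -- The form takes real values, so the sign of its real part decides.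
    rw [star_dotProduct_mulVec_self hS hdiag] at h1 ⊢
    rw [RCLike.ofReal_re] at h1
    exact RCLike.ofReal_nonneg.2 h1
  tfae_have 3 ↔ 4 := and_congr_right fun _ => hker
  tfae_have 3 → 2 := fun h => isDissipative_opA hP₁ h.1 h.2
  tfae_have 1 ↔ 2 := by
    refine generatesContractionSemigroup_opAH_iff hiso fun hdiss l hl => ?_
    obtain ⟨h0, h1⟩ := tfae_2_to_3 hdiss
    -- Dissipativity gives nonnegativity on the kernel, hence `k = n₂`: the kernel has the maximal
    -- dimension that the range condition needs.
    have hdim : Module.finrank 𝕜 (LinearMap.ker WB.mulVecLin) = n₁ := by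
      obtain ⟨hkn, -⟩ := hker.1 h1
      have := finrank_ker_mulVecLin hWB
      omega
    exact exists_smul_sub_opA_eq hP₁_inv hdiss hiso hl fun w hw =>
      eq_zero_of_forall_inner_eq_zero hP₁ hP₁_inv hth hS hdiag h0 h1 hdim hiso hl hw
  tfae_finish
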